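/- Let $m\ge 1$, $n=2m+1$, let $p$ be a positive integer with $p\equiv\pm1 \pmod 8$, and let $z_j=x_j+iy_j$ $(0\le j\le n)$ be the coordinates of $\mathbb C^{n+1}$. Put $a_0=p$, $a_1=\dots=a_n=2$, $F(z)=\sum_{j=0}^n|z_j|^2$, and $$B_p=\Big\{z\in\mathbb C^{n+1}:\ F(z)=1,\ \sum_{j=0}^n z_j^{a_j}=0\Big\},\qquad \alpha=\frac14\sum_{j=0}^n a_j(x_j\,dy_j-y_j\,dx_j).$$ For $0<\epsilon_j<1$ $(j=1,\dots,m)$ let $$g_j=i(\bar z_{2j}z_{2j+1}-z_{2j}\bar z_{2j+1})=2(y_{2j}x_{2j+1}-y_{2j+1}x_{2j}),\qquad H=F+\sum_{j=1}^m\epsilon_jg_j .$$ Then $B_p$ is a regular level set of dimension $4m+1$ and $\alpha$ restricts to a contact form on it. Let $Z$ be its Reeb vector field ($\alpha(Z)=1$, $i_Zd\alpha=0$); for a smooth function $f$ on $B_p$ let $Y_f$ be the contact Hamiltonian vector field ($\alpha(Y_f)=f$, $-i_{Y_f}d\alpha=df-Z(f)\alpha$), and let $[f,g]=Y_f(g)-gZ(f)$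 be the Jacobi bracket on $B_p$. The contact flow $\dot z=Y_H$ on $B_p$ is completely integrable in the noncommutative sense, with $m+1$-dimensional generic invariant pre-isotropic tori spanned by the Reeb flow and the contact flows of $g_1,\dots,g_m$. That is, there are smooth functions $f_1,\dots,f_{3m}$ on $B_p$ such that: 1. $f_1,\dots,f_{3m}$ are integrals of $\dot z=Y_H$, $f_1=H$ on $B_p$, and $[1,f_i]=0$, $[f_i,f_j]=0$ on $B_p$ for $1\le i\le 3m$, $1\le j\le m$; the differentials of the restrictions of $f_1,\dots,f_{3m}$ to $B_p$ are linearly independent at all points of an open dense subset of $B_p$. 2. $g_1,\dots,g_m$ are integrals of $\dot z=Y_H$, and $[1,g_j]=0$, $[g_i,g_j]=0$, $[f_k,g_j]=0$ on $B_p$ for $1\le i,j\le m$, $1\le k\le 3m$. 3. For every $z\in B_p$ at which the differentials of the restrictions of $f_1,\dots,f_{3m}$ to $B_p$ are linearly independent, the connected component $T$ through $z$ of $\{w\in B_p: f_i(w)=f_i(z),\ 1\le i\le 3m\}$ is a smoothly embedded torus $\mathbb R^{m+1}/\mathbb Z^{m+1}$ of dimension $m+1$. It is pre-isotropic (it is transversal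 to $\ker\alpha$, and $d\alpha$ vanishes on $T_wT\cap\ker\alpha$ for every $w\in T$), $T_wT$ is spanned by $Z,Y_{g_1},\dots,Y_{g_m}$ for every $w\in T$, and on $T\cong\mathbb R^{m+1}/\mathbb Z^{m+1}$ the vector fields $Z$, $Y_{g_1},\dots,Y_{g_m}$ and $Y_H$ are constant (so $T$ is invariant under the flow of $Y_H$, which is quasi-periodic on it). -/

import Mathlib

open scoped ContDiff

noncomputable section

/-- A level set `M = {x | Φ x = 0}` in a real normed space `E`, together with a 1-form `α` on `E`
which is to be restricted to `M`.  (The conditions making `M` a submanifold and `α` a contact form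
on it are collected in `FormOnLevelSet.IsContact`.) -/
structure FormOnLevelSet (E V : Type*) [NormedAddCommGroup E] [NormedSpace ℝ E]
    [NormedAddCommGroup V] [NormedSpace ℝ V] where
  /-- the defining map `Φ` -/
  constraint : E → V
  /-- the 1-form `α` -/
  form : E → E →L[ℝ] ℝ

namespace FormOnLevelSet

variable {E V : Type*} [NormedAddCommGroup E] [NormedSpace ℝ E]
  [NormedAddCommGroup V] [NormedSpace ℝ V] (M : FormOnLevelSet E V)

/-- The points of `M`. -/
def carrier : Set E := {x | M.constraint x = 0}

/-- The tangent space `T_x M = ker dΦ_x` (the tangent space of a regular level set). -/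
def tangent (x : E) : Submodule ℝ E := (fderiv ℝ M.constraint x).ker

/-- The exterior derivative `dα_x(v, w) = (D_v α)(w) - (D_w α)(v)`. -/
def dform (x v w : E) : ℝ := fderiv ℝ M.form x v w - fderiv ℝ M.form x w v

/-- `M` is a regular level set of a smooth map, of dimension `2 N + 1`, and the smooth form `α`
restricts to a contact form on it: `α` does not vanish on any tangent space, and `dα` is
nondegenerate on the horizontal spaces `ker α ∩ T_x M`
(equivalently, `α ∧ (dα)^N ≠ 0` on every `T_x M`). -/
structure IsContact (N : ℕ) : Prop where
  smooth_constraint : ContDiff ℝ ∞ M.constraint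
  smooth_form : ContDiff ℝ ∞ M.form
  regular : ∀ x ∈ M.carrier, Function.Surjective (fderiv ℝ M.constraint x)
  dimension : ∀ x ∈ M.carrier, Module.finrank ℝ (M.tangent x) = 2 * N + 1
  form_ne_zero : ∀ x ∈ M.carrier, ∃ v ∈ M.tangent x, M.form x v ≠ 0
  nondegenerate : ∀ x ∈ M.carrier, ∀ v ∈ M.tangent x, M.form x v = 0 →
    (∀ w ∈ M.tangent x, M.form x w = 0 → M.dform x v w = 0) → v = 0

/-- `v` is the value at `x` of the Reeb vector field: `α(v) = 1` and `i_v dα = 0` on `T_x M`. -/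
def IsReebVector (x v : E) : Prop :=
  v ∈ M.tangent x ∧ M.form x v = 1 ∧ ∀ w ∈ M.tangent x, M.dform x v w = 0

/-- The Reeb vector field `Z` (see `reeb_spec` and `reebVector_unique`). -/
def reeb (x : E) : E := Classical.epsilon (M.IsReebVector x)

/-- `v` is the value at `x` of the contact Hamiltonian vector field
`Y_f = f Z + α^♯(df - Z(f) α)`: it is tangent to `M`, `α(v) = f`, and
`- i_v dα = df - Z(f) α` on `T_x M`. -/
def IsContactVector (f : E → ℝ) (x v : E) : Prop :=
  v ∈ M.tangent x ∧ M.form x v = f x ∧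
    ∀ w ∈ M.tangent x, - M.dform x v w = fderiv ℝ f x w - fderiv ℝ f x (M.reeb x) * M.form x w

/-- The contact Hamiltonian vector field `Y_f` on `M` of the restriction to `M` of `f`
(see `contactField_spec` and `contactVector_unique`). -/
def contactField (f : E → ℝ) (x : E) : E := Classical.epsilon (M.IsContactVector f x)

/-- The Jacobi bracket `[f, g] = Y_f(g) - g Z(f)` of functions on `M`. -/
def bracket (f g : E → ℝ) (x : E) : ℝ :=
  fderiv ℝ g x (M.contactField f x) - g x * fderiv ℝ f x (M.reeb x)

/-- `g` is a first integral on `M` of the contact Hamiltonian equation `ẋ = Y_f`. -/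
def IsIntegralOf (f g : E → ℝ) : Prop :=
  ∀ x ∈ M.carrier, fderiv ℝ g x (M.contactField f x) = 0

/-- The differentials at `x` of the restrictions of the functions `F i` to `M` are linearly
independent. -/
def IndependentAt {k : ℕ} (F : Fin k → E → ℝ) (x : E) : Prop :=
  LinearIndependent ℝ
    (fun i => ((fderiv ℝ (F i) x : E →L[ℝ] ℝ) : E →ₗ[ℝ] ℝ).comp (M.tangent x).subtype)

/-- Noncommutative integrability of the contact flow `ẋ = Y_f` on the `(2 N + 1)`-dimensional
contact manifold `M`, through the smooth integrals `F 0, …, F (k - 1)`, `k = 2 N - r`, the first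
`r` of which commute with all of them; here `f = F 0` or `f = 1` on `M`, and the integrals are
independent on an open dense subset of `M`. -/
structure IsNoncommutativelyIntegrable (N r : ℕ) (f : E → ℝ) {k : ℕ} (F : Fin k → E → ℝ) :
    Prop where
  contact : M.IsContact N
  count : k + r = 2 * N
  le : r ≤ k
  smooth : ∀ i, ContDiff ℝ ∞ (F i)
  hamiltonian : (∃ h : 0 < k, 0 < r ∧ Set.EqOn f (F ⟨0, h⟩) M.carrier) ∨
    Set.EqOn f (fun _ => 1) M.carrier
  isIntegral : ∀ i, M.IsIntegralOf f (F i)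
  bracket_one : ∀ i, ∀ x ∈ M.carrier, M.bracket (fun _ => 1) (F i) x = 0
  bracket_eq_zero : ∀ i j : Fin k, j.val < r → ∀ x ∈ M.carrier, M.bracket (F i) (F j) x = 0
  independent : ∃ U : Set E, IsOpen U ∧ M.carrier ⊆ closure (M.carrier ∩ U) ∧
    ∀ x ∈ M.carrier ∩ U, M.IndependentAt F x

/-- `φ : ℝ^d → M` induces an embedding of the torus `ℝ^d / ℤ^d` as a pre-isotropic submanifold of
`M`: a submanifold which is transversal to the horizontal distribution `ker α` and whose tangent
spaces meet it in isotropic subspaces. -/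
structure IsPreIsotropicTorus (d : ℕ) (φ : (Fin d → ℝ) → E) : Prop where
  smooth : ContDiff ℝ ∞ φ
  immersion : ∀ θ, Function.Injective (fderiv ℝ φ θ)
  eq_iff : ∀ θ θ', φ θ = φ θ' ↔ ∃ k : Fin d → ℤ, ∀ i, θ' i = θ i + k i
  mem : ∀ θ, φ θ ∈ M.carrier
  transversal : ∀ θ, ∃ u, M.form (φ θ) (fderiv ℝ φ θ u) ≠ 0
  isotropic : ∀ θ u v, M.form (φ θ) (fderiv ℝ φ θ u) = 0 → M.form (φ θ) (fderiv ℝ φ θ v) = 0 →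
    M.dform (φ θ) (fderiv ℝ φ θ u) (fderiv ℝ φ θ v) = 0

/-! ### The Reeb field and the contact Hamiltonian fields are well defined -/

variable {M}

theorem reebVector_unique {N : ℕ} (hM : M.IsContact N) {x : E} (hx : x ∈ M.carrier) {v w : E}
    (hv : M.IsReebVector x v) (hw : M.IsReebVector x w) : v = w := by
  refine sub_eq_zero.1 (hM.nondegenerate x hx _ (Submodule.sub_mem _ hv.1 hw.1) ?_ ?_)
  · rw [map_sub, hv.2.1, hw.2.1, sub_self]
  · intro u hu _
    have h1 := hv.2.2 u hu
    have h2 := hw.2.2 u hu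
    simp only [dform, map_sub, _root_.sub_apply] at *
    linarith

theorem contactVector_unique {N : ℕ} (hM : M.IsContact N) {f : E → ℝ} {x : E}
    (hx : x ∈ M.carrier) {v w : E}
    (hv : M.IsContactVector f x v) (hw : M.IsContactVector f x w) : v = w := by
  refine sub_eq_zero.1 (hM.nondegenerate x hx _ (Submodule.sub_mem _ hv.1 hw.1) ?_ ?_)
  · rw [map_sub, hv.2.1, hw.2.1, sub_self]
  · intro u hu _
    have h1 := hv.2.2 u hu
    have h2 := hw.2.2 u hu
    simp only [dform, map_sub, _root_.sub_apply] at *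
    linarith

/-- Nondegeneracy: every functional on the horizontal space is `dα(h, ·)`, `h` horizontal. -/
theorem exists_horizontal [FiniteDimensional ℝ E] {N : ℕ} (hM : M.IsContact N) {x : E}
    (hx : x ∈ M.carrier) (l : E →ₗ[ℝ] ℝ) :
    ∃ h ∈ M.tangent x, M.form x h = 0 ∧
      ∀ w ∈ M.tangent x, M.form x w = 0 → M.dform x h w = l w := by
  let H : Submodule ℝ E := M.tangent x ⊓ (M.form x).ker
  let B : H →ₗ[ℝ] (H →ₗ[ℝ] ℝ) := LinearMap.mk₂ ℝ (fun v w => M.dform x v w)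
    (by intro a b c; simp [dform]; ring) (by intro a b c; simp [dform]; ring)
    (by intro a b c; simp [dform]; ring) (by intro a b c; simp [dform]; ring)
  have hinj : Function.Injective B := by
    rw [injective_iff_map_eq_zero]
    intro v hv
    apply Subtype.ext
    refine hM.nondegenerate x hx v v.2.1 v.2.2 ?_
    intro w hw hw0
    exact congrArg (fun L : H →ₗ[ℝ] ℝ => L ⟨w, hw, hw0⟩) hv
  have hsurj : Function.Surjective B :=
    (LinearMap.injective_iff_surjective_of_finrank_eq_finrank
      (Subspace.dual_finrank_eq (K := ℝ) (V := H)).symm).1 hinj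
  obtain ⟨h, hh⟩ := hsurj (l.comp H.subtype)
  refine ⟨h, h.2.1, h.2.2, fun w hw hw0 => ?_⟩
  exact congrArg (fun L : H →ₗ[ℝ] ℝ => L ⟨w, hw, hw0⟩) hh

theorem reeb_spec [FiniteDimensional ℝ E] {N : ℕ} (hM : M.IsContact N) {x : E}
    (hx : x ∈ M.carrier) : M.IsReebVector x (M.reeb x) := by
  apply Classical.epsilon_spec (p := M.IsReebVector x)
  obtain ⟨v, hv, hv0⟩ := hM.form_ne_zero x hx
  let l : E →ₗ[ℝ] ℝ :=
    { toFun := fun w => - M.dform x v w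
      map_add' := by intro a b; simp [dform]; ring
      map_smul' := by intro a b; simp [dform]; ring }
  obtain ⟨h, hh, hh0, hhl⟩ := exists_horizontal hM hx l
  have key : ∀ w ∈ M.tangent x, M.form x w = 0 → M.dform x (v + h) w = 0 := by
    intro w hw hw0
    have h1 : M.dform x h w = - M.dform x v w := hhl w hw hw0
    simp only [dform, map_add, _root_.add_apply] at *
    linarith
  refine ⟨(M.form x v)⁻¹ • (v + h), Submodule.smul_mem _ _ (Submodule.add_mem _ hv hh), ?_, ?_⟩
  · simp [hh0, hv0]
  · intro w hw
    have h2 := key (w - (M.form x w / M.form x v) • (v + h))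
      (Submodule.sub_mem _ hw (Submodule.smul_mem _ _ (Submodule.add_mem _ hv hh)))
      (by simp [hh0, hv0])
    have h3 : M.dform x (v + h) w = 0 := by
      simp only [dform, map_sub, map_smul, _root_.sub_apply,
        _root_.smul_apply, smul_eq_mul] at *
      linarith
    simp only [dform, map_smul, _root_.smul_apply, smul_eq_mul] at *
    rw [← mul_sub, h3, mul_zero]

theorem contactField_spec [FiniteDimensional ℝ E] {N : ℕ} (hM : M.IsContact N) (f : E → ℝ) {x : E}
    (hx : x ∈ M.carrier) : M.IsContactVector f x (M.contactField f x) := by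
  apply Classical.epsilon_spec (p := M.IsContactVector f x)
  obtain ⟨hZ, hZ1, hZ2⟩ := reeb_spec hM hx
  obtain ⟨h, hh, hh0, hhl⟩ := exists_horizontal hM hx
    (-((fderiv ℝ f x : E →L[ℝ] ℝ) : E →ₗ[ℝ] ℝ))
  refine ⟨f x • M.reeb x + h, Submodule.add_mem _ (Submodule.smul_mem _ _ hZ) hh, ?_, ?_⟩
  · simp [hZ1, hh0]
  · intro w hw
    have h1 := hZ2 w hw
    have h2 := hZ2 h hh
    have h3 := hhl (w - M.form x w • M.reeb x)
      (Submodule.sub_mem _ hw (Submodule.smul_mem _ _ hZ)) (by simp [hZ1])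
    simp only [dform, map_sub, map_add, map_smul, _root_.sub_apply,
      _root_.add_apply, _root_.smul_apply, smul_eq_mul,
      LinearMap.neg_apply, ContinuousLinearMap.coe_coe] at *
    linear_combination (-(f x)) * h1 + M.form x w * h2 - h3

end FormOnLevelSet

/-! ### Brieskorn manifolds -/

/-- `F(z) = ∑ |z_j|²`. -/
def sqNorm {ι : Type*} [Fintype ι] (z : ι → ℂ) : ℝ := ∑ j, Complex.normSq (z j)

/-- `α = (1/4) ∑ a_j (x_j dy_j - y_j dx_j)`, where `z_j = x_j + i y_j`. -/
def brieskornForm {ι : Type*} [Fintype ι] (a : ι → ℕ) (z : ι → ℂ) : (ι → ℂ) →L[ℝ] ℝ :=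
  (1 / 4 : ℝ) • ∑ j, (a j : ℝ) •
    ((z j).re • Complex.imCLM.comp (ContinuousLinearMap.proj (R := ℝ) (φ := fun _ : ι => ℂ) j) -
      (z j).im • Complex.reCLM.comp (ContinuousLinearMap.proj (R := ℝ) (φ := fun _ : ι => ℂ) j))

/-- The Brieskorn manifold `{z | ∑ |z_j|² = 1, ∑ z_j ^ a_j = 0}` with its form `α`. -/
def brieskorn {ι : Type*} [Fintype ι] (a : ι → ℕ) : FormOnLevelSet (ι → ℂ) (ℝ × ℂ) where
  constraint := fun z => (sqNorm z - 1, ∑ j, z j ^ a j)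
  form := brieskornForm a

/-- The Brieskorn manifold `B_p` in `ℂ^(n+1)`, `n = 2 m + 1`, with exponents
`a_0 = p`, `a_1 = ⋯ = a_n = 2`. -/
def ustilovsky (m p : ℕ) : FormOnLevelSet (Fin (2 * m + 2) → ℂ) (ℝ × ℂ) :=
  brieskorn (fun j => if j = 0 then p else 2)

/-- `g_j = i (z̄_{2j} z_{2j+1} - z_{2j} z̄_{2j+1}) = 2 (y_{2j} x_{2j+1} - y_{2j+1} x_{2j})`,
for `j = 1, …, m`; the index `j : Fin m` of Lean stands for `j + 1`. -/
def ustilovskyG {m : ℕ} (j : Fin m) (z : Fin (2 * m + 2) → ℂ) : ℝ :=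
  2 * ((z ⟨2 * (j + 1), by omega⟩).im * (z ⟨2 * (j + 1) + 1, by omega⟩).re -
    (z ⟨2 * (j + 1) + 1, by omega⟩).im * (z ⟨2 * (j + 1), by omega⟩).re)

/-- `H = F + ∑ ε_j g_j`. -/
def ustilovskyH {m : ℕ} (ε : Fin m → ℝ) (z : Fin (2 * m + 2) → ℂ) : ℝ :=
  sqNorm z + ∑ j, ε j * ustilovskyG j z

end

/-! In the coordinates `z_0`, `z_1`, `u_j = z_{2j} + i z_{2j+1}`, `v_j = z_{2j} - i z_{2j+1}` the
constraint becomes `z_0 ^ p + z_1 ^ 2 + ∑ u_j v_j = 0`, and the Reeb flow and the contact flows of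
the `g_j` together form a diagonal action of `ℝ^(m+1)`. On `B_p` the functions `F` and `g_j` are the
Hamiltonians of this action, so every invariant function is an integral of `H` and commutes with the
`g_j`. For a fixed `k`, the invariants `|v_j|²`, `Im (u_j v_j z̄_1²)` with `j ≠ k`, and `|z_1|²`,
together with `m` independent combinations of `F` and the `g_j`, are `3 m` integrals, independent in
general position; such points are dense in the cone over `B_p` by analyticity, and in `B_p` itself
after a weighted dilation. At a point of independence the orbit of the action has dimension `m + 1`,
the dimension of the common level set, so it is open in it; being compact, it is a torus and the
connected component of the point. -/

noncomputable section

open Filter Topology Module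

open ComplexConjugate in
theorem eq_zero_of_im_mul_eq_zero {μ x y : ℂ} (hx : (μ * x).im = 0) (hy : (μ * y).im = 0)
    (hxy : (conj x * y).im ≠ 0) : μ = 0 := by
  simp only [Complex.mul_im, Complex.conj_re, Complex.conj_im] at *
  apply Complex.ext
  · refine (mul_eq_zero.1 ?_).resolve_right hxy
    linear_combination x.re * hy - y.re * hx
  · refine (mul_eq_zero.1 ?_).resolve_right hxy
    linear_combination y.im * hx - x.im * hy

section LinearAlgebra

variable {E W : Type*} [AddCommGroup E] [Module ℝ E] [AddCommGroup W] [Module ℝ W]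

theorem exists_eq_comp_of_ker_le_ker {L : E →ₗ[ℝ] W} {l : E →ₗ[ℝ] ℝ}
    (h : LinearMap.ker L ≤ LinearMap.ker l) : ∃ f : W →ₗ[ℝ] ℝ, l = f ∘ₗ L := by
  have hl : l ∈ (LinearMap.ker L).dualAnnihilator :=
    (Submodule.mem_dualAnnihilator l).2 fun v hv => h hv
  rw [← LinearMap.range_dualMap_eq_dualAnnihilator_ker] at hl
  obtain ⟨f, rfl⟩ := hl
  exact ⟨f, rfl⟩

theorem exists_apply_eq_add_re_mul (f : ℝ × ℂ →ₗ[ℝ] ℝ) :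
    ∃ (l : ℝ) (μ : ℂ), ∀ s c, f (s, c) = l * s + (μ * c).re := by
  refine ⟨f (1, 0), ⟨f (0, 1), -f (0, Complex.I)⟩, fun s c => ?_⟩
  have h : ((s, c) : ℝ × ℂ) = s • ((1 : ℝ), (0 : ℂ)) + c.re • ((0 : ℝ), (1 : ℂ)) +
      c.im • ((0 : ℝ), Complex.I) := by
    ext <;> simp
  rw [h, map_add, map_add, map_smul, map_smul, map_smul]
  simp only [smul_eq_mul, Complex.mul_re]
  ring

theorem finrank_iInf_ker_of_linearIndependent [FiniteDimensional ℝ E] {k : ℕ}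
    {l : Fin k → E →ₗ[ℝ] ℝ} (hl : LinearIndependent ℝ l) :
    k + finrank ℝ (⨅ i, LinearMap.ker (l i) : Submodule ℝ E) = finrank ℝ E := by
  have hker : (⨅ i, LinearMap.ker (l i)) =
      (Submodule.span ℝ (Set.range l)).dualCoannihilator := by
    refine le_antisymm (fun x hx => ?_) fun x hx => ?_
    · rw [Submodule.mem_dualCoannihilator]
      intro φ hφ
      obtain ⟨c, rfl⟩ := (Submodule.mem_span_range_iff_exists_fun ℝ).1 hφ
      simp only [LinearMap.sum_apply, LinearMap.smul_apply,
        LinearMap.mem_ker.1 ((Submodule.mem_iInf _).1 hx _), smul_zero, Finset.sum_const_zero]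
    · exact (Submodule.mem_iInf _).2 fun i =>
        (Submodule.mem_dualCoannihilator _).1 hx _ (Submodule.subset_span ⟨i, rfl⟩)
  have h := Subspace.finrank_add_finrank_dualCoannihilator_eq (Submodule.span ℝ (Set.range l))
  rwa [finrank_span_eq_card hl, Fintype.card_fin, ← hker] at h

end LinearAlgebra

section Fibre

variable {E W P : Type*} [NormedAddCommGroup E] [NormedSpace ℝ E] [FiniteDimensional ℝ E]
  [NormedAddCommGroup W] [NormedSpace ℝ W] [FiniteDimensional ℝ W]
  [NormedAddCommGroup P] [NormedSpace ℝ P] [FiniteDimensional ℝ P]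

theorem exists_injOn_nhds_of_injective_fderiv {f : E → W} {f' : E →L[ℝ] W} {a : E}
    (hf : HasStrictFDerivAt f f' a) (hinj : Function.Injective f') :
    ∃ U ∈ 𝓝 a, Set.InjOn f U := by
  obtain ⟨g, hg⟩ := (f' : E →ₗ[ℝ] W).exists_leftInverse_of_injective
    (LinearMap.ker_eq_bot.2 hinj)
  have : CompleteSpace E := FiniteDimensional.complete ℝ E
  let gc : W →L[ℝ] E := LinearMap.toContinuousLinearMap g
  have hcomp : gc.comp f' = (ContinuousLinearEquiv.refl ℝ E : E →L[ℝ] E) := by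
    ext v
    exact LinearMap.congr_fun hg v
  have hgf := gc.hasStrictFDerivAt.comp a hf
  rw [hcomp] at hgf
  let e := hgf.toOpenPartialHomeomorph
  refine ⟨e.source, e.open_source.mem_nhds hgf.mem_toOpenPartialHomeomorph_source,
    fun x hx y hy hxy => e.injOn hx hy (congrArg gc hxy)⟩

/-- A left inverse `g` of `D` makes `(G, g)` locally injective and `g ∘ φ` locally surjective; a
point `w` of the fibre near `φ t` therefore equals the point `φ s` with `g (φ s) = g w`. -/
theorem eventually_mem_range_of_mem_fibre {G : E → W} {φ : P → E}
    {G' : E →L[ℝ] W} {D : P →L[ℝ] E} {t : P}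
    (hG : HasStrictFDerivAt G G' (φ t)) (hφ : HasStrictFDerivAt φ D t)
    (hD : Function.Injective D) (hker : ∀ v, G' v = 0 → ∃ s, D s = v)
    (hconst : ∀ s, G (φ s) = G (φ t)) :
    ∀ᶠ w in 𝓝 (φ t), G w = G (φ t) → w ∈ Set.range φ := by
  obtain ⟨g, hg⟩ := (D : P →ₗ[ℝ] E).exists_leftInverse_of_injective (LinearMap.ker_eq_bot.2 hD)
  have : CompleteSpace P := FiniteDimensional.complete ℝ P
  let gc : E →L[ℝ] P := LinearMap.toContinuousLinearMap g
  have hgD (s : P) : gc (D s) = s := LinearMap.congr_fun hg s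
  have hinj : Function.Injective (G'.prod gc) := by
    rw [injective_iff_map_eq_zero]
    intro v hv
    obtain ⟨hv₁, hv₂⟩ := Prod.ext_iff.1 hv
    obtain ⟨s, rfl⟩ := hker v hv₁
    rw [← hgD s, show gc (D s) = 0 from hv₂, map_zero]
  obtain ⟨U, hU, hinjU⟩ :=
    exists_injOn_nhds_of_injective_fderiv (hG.prodMk (gc.hasStrictFDerivAt (x := φ t))) hinj
  have hgφ := (gc.hasStrictFDerivAt (x := φ t)).comp t hφ
  rw [show gc.comp D = (ContinuousLinearEquiv.refl ℝ P : P →L[ℝ] P) from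
    ContinuousLinearMap.ext hgD] at hgφ
  have himage : gc ∘ φ '' (φ ⁻¹' U) ∈ 𝓝 (gc (φ t)) := by
    rw [← hgφ.map_nhds_eq_of_equiv]
    exact image_mem_map (hφ.continuousAt.preimage_mem_nhds hU)
  filter_upwards [hU, gc.continuous.continuousAt.preimage_mem_nhds himage] with w hw hw' hGw
  obtain ⟨s, hs, hsw⟩ := hw'
  exact ⟨s, hinjU hs hw (Prod.ext ((hconst s).trans hGw.symm) hsw)⟩

end Fibre

theorem subset_of_isPreconnected_of_isClosed {X : Type*} [TopologicalSpace X] {s t : Set X}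
    (hs : IsPreconnected s) (ht : IsClosed t) (hst : ∀ x ∈ s ∩ t, t ∈ 𝓝[s] x)
    (hne : (s ∩ t).Nonempty) : s ⊆ t := by
  have : PreconnectedSpace s := isPreconnected_iff_preconnectedSpace.1 hs
  have hclopen : IsClopen ((↑) ⁻¹' t : Set s) :=
    ⟨ht.preimage continuous_subtype_val, isOpen_iff_mem_nhds.2 fun x hx =>
      preimage_coe_mem_nhds_subtype.2 (hst x ⟨x.2, hx⟩)⟩
  obtain ⟨x, hxs, hxt⟩ := hne
  exact fun y hy => (hclopen.eq_univ ⟨⟨x, hxs⟩, hxt⟩ ▸ Set.mem_univ (⟨y, hy⟩ : s) :)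

section Orbit

variable {E : Type*} [NormedAddCommGroup E] [NormedSpace ℝ E] {d : ℕ}

theorem neg_apply_apply (A : AddChar (Fin d → ℝ) (E →L[ℝ] E)) (t : Fin d → ℝ) (z : E) :
    A (-t) (A t z) = z := by
  rw [← mul_apply_eq_comp, ← A.map_add_eq_mul, neg_add_cancel, A.map_zero_eq_one,
    one_apply_eq_self]

/-- The stabilizer of `z` under a linear action `A` of `ℝ^d`, as a `ℤ`-submodule, so that the
theory of lattices applies to it. -/
def stabilizerLattice (A : AddChar (Fin d → ℝ) (E →L[ℝ] E)) (z : E) :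
    Submodule ℤ (Fin d → ℝ) :=
  AddSubgroup.toIntSubmodule
    { carrier := {t | A t z = z}
      zero_mem' := by simp
      add_mem' := fun {s t} (hs : A s z = z) (ht : A t z = z) => by
        rw [Set.mem_ofPred_eq, A.map_add_eq_mul, mul_apply_eq_comp, ht, hs]
      neg_mem' := fun {t} (ht : A t z = z) => by
        rw [Set.mem_ofPred_eq]
        nth_rw 1 [← ht]
        exact neg_apply_apply A t z }

variable {A : AddChar (Fin d → ℝ) (E →L[ℝ] E)} {z : E}

theorem mem_stabilizerLattice {t : Fin d → ℝ} : t ∈ stabilizerLattice A z ↔ A t z = z := Iff.rfl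

theorem discreteTopology_stabilizerLattice [FiniteDimensional ℝ E] {D : (Fin d → ℝ) →L[ℝ] E}
    (hφ : HasStrictFDerivAt (fun t => A t z) D 0) (hD : Function.Injective D) :
    DiscreteTopology (stabilizerLattice A z) := by
  obtain ⟨U, hU, hinj⟩ := exists_injOn_nhds_of_injective_fderiv hφ hD
  obtain ⟨V, hVU, hV, h0V⟩ := mem_nhds_iff.1 hU
  refine discreteTopology_iff_isOpen_singleton_zero.mpr ⟨V, hV, Set.ext fun t => ?_⟩
  refine ⟨fun ht => Subtype.ext (hinj (hVU ht) (hVU h0V) ?_), fun ht => ?_⟩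
  · simpa using mem_stabilizerLattice.1 t.2
  · rw [Set.mem_singleton_iff.1 ht]
    exact h0V

theorem isZLattice_stabilizerLattice [DiscreteTopology (stabilizerLattice A z)] {c : Fin d → ℝ}
    (hc : ∀ i, c i ≠ 0) (hper : ∀ i, A (Pi.single i (c i)) z = z) :
    IsZLattice ℝ (stabilizerLattice A z) := by
  refine ⟨eq_top_iff.2 fun t _ => ?_⟩
  rw [pi_eq_sum_univ' t]
  refine Submodule.sum_mem _ fun i _ => ?_
  have hi : t i • (Pi.single i 1 : Fin d → ℝ) = (t i / c i) • Pi.single i (c i) := by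
    rw [← Pi.single_smul, ← Pi.single_smul, smul_eq_mul, smul_eq_mul, mul_one,
      div_mul_cancel₀ _ (hc i)]
  rw [hi]
  exact Submodule.smul_mem _ _ (Submodule.subset_span (mem_stabilizerLattice.2 (hper i)))

theorem isCompact_range_orbit [DiscreteTopology (stabilizerLattice A z)]
    [IsZLattice ℝ (stabilizerLattice A z)] (hcont : Continuous fun t => A t z) :
    IsCompact (Set.range fun t => A t z) :=
  IsZLattice.isCompact_range_of_periodic (stabilizerLattice A z) _ hcont fun s t ht => by
    rw [A.map_add_eq_mul, mul_apply_eq_comp, mem_stabilizerLattice.1 ht]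

theorem exists_basis_apply_eq_self_iff [DiscreteTopology (stabilizerLattice A z)]
    [IsZLattice ℝ (stabilizerLattice A z)] :
    ∃ b : Basis (Fin d) ℝ (Fin d → ℝ),
      ∀ t, A t z = z ↔ ∃ k : Fin d → ℤ, ∀ i, b.repr t i = k i := by
  set L := stabilizerLattice A z
  let b := IsZLattice.basis L
  refine ⟨b.ofZLatticeBasis ℝ L, fun t => ⟨fun ht => ⟨fun i => b.repr ⟨t, ht⟩ i, fun i =>
    b.ofZLatticeBasis_repr_apply ℝ L ⟨t, ht⟩ i⟩, ?_⟩⟩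
  rintro ⟨k, hk⟩
  have ht : t = ∑ i, k i • (b i : Fin d → ℝ) := by
    rw [← (b.ofZLatticeBasis ℝ L).sum_repr t]
    refine Finset.sum_congr rfl fun i _ => ?_
    rw [hk i, Basis.ofZLatticeBasis_apply, Int.cast_smul_eq_zsmul]
  rw [← mem_stabilizerLattice, ht]
  exact Submodule.sum_mem _ fun i _ => Submodule.smul_mem _ _ (b i).2

theorem apply_equivFun_symm_eq_iff {b : Basis (Fin d) ℝ (Fin d → ℝ)}
    (hb : ∀ t, A t z = z ↔ ∃ k : Fin d → ℤ, ∀ i, b.repr t i = k i) (θ θ' : Fin d → ℝ) :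
    A (b.equivFun.symm θ) z = A (b.equivFun.symm θ') z ↔
      ∃ k : Fin d → ℤ, ∀ i, θ' i = θ i + k i := by
  have hsub : A (b.equivFun.symm θ) z = A (b.equivFun.symm θ') z ↔
      A (b.equivFun.symm (θ' - θ)) z = z := by
    rw [map_sub, sub_eq_neg_add, A.map_add_eq_mul, mul_apply_eq_comp]
    refine ⟨fun h => by rw [← h, neg_apply_apply], fun h => ?_⟩
    nth_rw 1 [← h]
    simpa only [neg_neg] using neg_apply_apply A (-b.equivFun.symm θ) _
  rw [hsub, hb]
  refine exists_congr fun k => forall_congr' fun i => ?_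
  rw [← Basis.equivFun_apply, LinearEquiv.apply_symm_apply, Pi.sub_apply, sub_eq_iff_eq_add']

theorem range_orbit_mem_nhdsWithin {S : Set E} (hS : ∀ t, ∀ w ∈ S, A t w ∈ S)
    (hloc : ∀ᶠ w in 𝓝 z, w ∈ S → w ∈ Set.range fun t => A t z) (t : Fin d → ℝ) :
    (Set.range fun t => A t z) ∈ 𝓝[S] (A t z) := by
  have htend : Tendsto (A (-t)) (𝓝 (A t z)) (𝓝 z) := by
    simpa only [neg_apply_apply] using (A (-t)).continuous.tendsto (A t z)
  refine eventually_nhdsWithin_iff.2 ((htend.eventually hloc).mono fun w hw hwS => ?_)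
  obtain ⟨s, hs⟩ := hw (hS _ w hwS)
  refine ⟨t + s, ?_⟩
  dsimp only at hs ⊢
  rw [A.map_add_eq_mul, mul_apply_eq_comp, hs]
  simpa only [neg_neg] using neg_apply_apply A (-t) w

theorem range_orbit_eq_connectedComponentIn {S : Set E} (hz : z ∈ S)
    (hS : ∀ t, ∀ w ∈ S, A t w ∈ S) (hcont : Continuous fun t => A t z)
    (hclosed : IsClosed (Set.range fun t => A t z))
    (hloc : ∀ᶠ w in 𝓝 z, w ∈ S → w ∈ Set.range fun t => A t z) :
    (Set.range fun t => A t z) = connectedComponentIn S z := by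
  have hzO : z ∈ Set.range fun t => A t z := ⟨0, by simp⟩
  refine Set.Subset.antisymm ?_ ?_
  · refine (isPreconnected_range hcont).subset_connectedComponentIn hzO ?_
    rintro _ ⟨t, rfl⟩
    exact hS t z hz
  · refine subset_of_isPreconnected_of_isClosed isPreconnected_connectedComponentIn hclosed ?_
      ⟨z, mem_connectedComponentIn hz, hzO⟩
    rintro _ ⟨-, t, rfl⟩
    exact nhdsWithin_mono _ (connectedComponentIn_subset S z)
      (range_orbit_mem_nhdsWithin hS hloc t)

end Orbit

namespace FormOnLevelSet

variable {E V : Type*} [NormedAddCommGroup E] [NormedSpace ℝ E]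
  [NormedAddCommGroup V] [NormedSpace ℝ V] {M : FormOnLevelSet E V}

theorem dform_swap (x v w : E) : M.dform x w v = -M.dform x v w := by
  rw [dform, dform, neg_sub]

variable [FiniteDimensional ℝ E] {N : ℕ} (hM : M.IsContact N) {f g : E → ℝ} {x v : E}
  (hx : x ∈ M.carrier)
include hM hx

theorem IsContact.reeb_eq (hv : M.IsReebVector x v) : M.reeb x = v :=
  reebVector_unique hM hx (reeb_spec hM hx) hv

theorem IsContact.contactField_eq_of_dform_eq (hv : v ∈ M.tangent x) (hfv : M.form x v = f x)
    (hdf : ∀ w ∈ M.tangent x, M.dform x v w = -fderiv ℝ f x w) : M.contactField f x = v := by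
  obtain ⟨hZ, -, hZd⟩ := reeb_spec hM hx
  have hfZ : fderiv ℝ f x (M.reeb x) = 0 := by
    rw [← neg_eq_zero, ← hdf _ hZ, dform_swap, hZd _ hv, neg_zero]
  refine contactVector_unique hM hx (contactField_spec hM f hx) ⟨hv, hfv, fun w hw => ?_⟩
  rw [hdf w hw, hfZ, zero_mul, sub_zero, neg_neg]

theorem IsContact.bracket_one : M.bracket (fun _ => 1) g x = fderiv ℝ g x (M.reeb x) := by
  obtain ⟨hZ, hZ1, hZd⟩ := reeb_spec hM hx
  have hY : M.contactField (fun _ => 1) x = M.reeb x :=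
    hM.contactField_eq_of_dform_eq hx hZ hZ1 fun w hw => by simp [hZd w hw]
  simp [bracket, hY]

theorem IsContact.bracket_eq_neg_fderiv_contactField (hf : fderiv ℝ f x (M.reeb x) = 0)
    (hg : fderiv ℝ g x (M.reeb x) = 0) :
    M.bracket f g x = -fderiv ℝ f x (M.contactField g x) := by
  obtain ⟨hYf, -, hfd⟩ := contactField_spec hM f hx
  obtain ⟨hYg, -, hgd⟩ := contactField_spec hM g hx
  have hfg := hfd _ hYg
  have hgf := hgd _ hYf
  rw [hf, zero_mul, sub_zero] at hfg
  rw [hg, zero_mul, sub_zero, dform_swap, neg_neg] at hgf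
  rw [bracket, hf, mul_zero, sub_zero, ← hfg, ← hgf, neg_neg]

end FormOnLevelSet

section Brieskorn

open ComplexConjugate

theorem hasFDerivAt_normSq_apply {E : Type*} [NormedAddCommGroup E] [NormedSpace ℝ E]
    (L : E →L[ℝ] ℂ) (z : E) :
    HasFDerivAt (fun z => Complex.normSq (L z)) ((2 : ℝ) • (innerSL ℝ (L z)).comp L) z := by
  simp only [Complex.normSq_eq_norm_sq]
  exact ((hasStrictFDerivAt_norm_sq (L z)).hasFDerivAt.comp z L.hasFDerivAt).congr_fderiv
    (by rw [ContinuousLinearMap.smul_comp, ofNat_smul_eq_nsmul ℝ])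

variable {ι : Type*} [Fintype ι]

theorem brieskornForm_apply (a : ι → ℕ) (z v : ι → ℂ) :
    brieskornForm a z v = 1 / 4 * ∑ j, (a j : ℝ) * (conj (z j) * v j).im := by
  simp only [brieskornForm, _root_.smul_apply, _root_.sum_apply,
    _root_.sub_apply, ContinuousLinearMap.comp_apply, ContinuousLinearMap.proj_apply,
    Complex.imCLM_apply, Complex.reCLM_apply, smul_eq_mul, Complex.mul_im, Complex.conj_re,
    Complex.conj_im, neg_mul, ← sub_eq_add_neg]

theorem brieskornForm_swap (a : ι → ℕ) (z v : ι → ℂ) :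
    brieskornForm a z v = -brieskornForm a v z := by
  rw [brieskornForm_apply, brieskornForm_apply, ← mul_neg, ← Finset.sum_neg_distrib]
  refine congrArg _ (Finset.sum_congr rfl fun j _ => ?_)
  simp only [Complex.mul_im, Complex.conj_re, Complex.conj_im]
  ring

theorem isLinearMap_brieskornForm (a : ι → ℕ) : IsLinearMap ℝ (brieskornForm a) where
  map_add z w := by
    ext v
    rw [brieskornForm_swap, map_add, _root_.add_apply, brieskornForm_swap a z,
      brieskornForm_swap a w, neg_add]
  map_smul c z := by
    ext v
    rw [brieskornForm_swap, map_smul, _root_.smul_apply, brieskornForm_swap a z, smul_neg]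

theorem contDiff_brieskornForm (a : ι → ℕ) : ContDiff ℝ ∞ (brieskornForm a) :=
  (LinearMap.toContinuousLinearMap (isLinearMap_brieskornForm a).mk').contDiff

theorem dform_brieskorn (a : ι → ℕ) (x v w : ι → ℂ) :
    (brieskorn a).dform x v w = 2 * brieskornForm a v w := by
  have hd : fderiv ℝ (brieskornForm a) x =
      LinearMap.toContinuousLinearMap (isLinearMap_brieskornForm a).mk' :=
    (LinearMap.toContinuousLinearMap (isLinearMap_brieskornForm a).mk').fderiv
  change fderiv ℝ (brieskornForm a) x v w - fderiv ℝ (brieskornForm a) x w v = _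
  rw [hd]
  change brieskornForm a v w - brieskornForm a w v = _
  rw [brieskornForm_swap a w v]
  ring

theorem contDiff_sqNorm : ContDiff ℝ ∞ (sqNorm : (ι → ℂ) → ℝ) := by
  simp only [funext fun z : ι → ℂ => show sqNorm z = ∑ j, ‖z j‖ ^ 2 from
    Finset.sum_congr rfl fun j _ => Complex.normSq_eq_norm_sq (z j)]
  exact ContDiff.sum fun j _ => (contDiff_apply ℝ ℂ j).norm_sq ℝ

theorem hasFDerivAt_sqNorm (z : ι → ℂ) : HasFDerivAt sqNorm
    (∑ j, (2 : ℝ) • (innerSL ℝ (z j)).comp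
      (ContinuousLinearMap.proj (R := ℝ) (φ := fun _ : ι => ℂ) j)) z :=
  HasFDerivAt.fun_sum fun j _ =>
    hasFDerivAt_normSq_apply (ContinuousLinearMap.proj (R := ℝ) (φ := fun _ : ι => ℂ) j) z

theorem fderiv_sqNorm (z v : ι → ℂ) :
    fderiv ℝ sqNorm z v = 2 * ∑ j, (conj (z j) * v j).re := by
  rw [(hasFDerivAt_sqNorm z).fderiv, Finset.mul_sum]
  simp [mul_comm]

theorem contDiff_brieskorn_constraint (a : ι → ℕ) : ContDiff ℝ ∞ (brieskorn a).constraint :=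
  (contDiff_sqNorm.sub contDiff_const).prodMk (by fun_prop)

theorem fderiv_brieskorn_constraint (a : ι → ℕ) (z v : ι → ℂ) :
    fderiv ℝ (brieskorn a).constraint z v =
      (fderiv ℝ sqNorm z v, ∑ j, (a j : ℂ) * z j ^ (a j - 1) * v j) := by
  have hpoly : HasFDerivAt (fun z : ι → ℂ => ∑ j, z j ^ a j)
      (∑ j, ((a j : ℂ) * z j ^ (a j - 1)) •
        ContinuousLinearMap.proj (R := ℝ) (φ := fun _ : ι => ℂ) j) z :=
    HasFDerivAt.fun_sum fun j _ => by
      have hj := ((ContinuousLinearMap.proj (R := ℝ) (φ := fun _ : ι => ℂ) j).hasFDerivAt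
        (x := z)).pow (a j)
      exact hj.congr_fderiv (by ext; simp)
  have h : HasFDerivAt (brieskorn a).constraint _ z :=
    (((hasFDerivAt_sqNorm z).sub_const 1).prodMk hpoly)
  rw [h.fderiv, (hasFDerivAt_sqNorm z).fderiv]
  simp

variable {a : ι → ℕ} {z v : ι → ℂ}

theorem mem_brieskorn_carrier : z ∈ (brieskorn a).carrier ↔ sqNorm z = 1 ∧ ∑ j, z j ^ a j = 0 := by
  change (sqNorm z - 1, ∑ j, z j ^ a j) = (0 : ℝ × ℂ) ↔ _
  rw [Prod.mk_eq_zero, sub_eq_zero]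

theorem mem_brieskorn_tangent : v ∈ (brieskorn a).tangent z ↔
    fderiv ℝ sqNorm z v = 0 ∧ ∑ j, (a j : ℂ) * z j ^ (a j - 1) * v j = 0 := by
  rw [FormOnLevelSet.tangent, LinearMap.mem_ker, ContinuousLinearMap.coe_coe,
    fderiv_brieskorn_constraint, Prod.mk_eq_zero]

/-- The weighted Euler field `(4 / a_j) z_j`, normalized so that `i` times it is the Reeb field. -/
def brieskornEuler (a : ι → ℕ) (z : ι → ℂ) : ι → ℂ := fun j => 4 / (a j : ℂ) * z j

/-- The field `(4 i / a_j) z_j`, which restricts to the Reeb field of the Brieskorn manifold. -/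
def brieskornReeb (a : ι → ℕ) (z : ι → ℂ) : ι → ℂ := Complex.I • brieskornEuler a z

theorem exists_ne_zero_of_mem_brieskorn_carrier (hz : z ∈ (brieskorn a).carrier) :
    ∃ k, z k ≠ 0 := by
  by_contra! h
  simpa [sqNorm, h] using (mem_brieskorn_carrier.1 hz).1

section NonzeroExponents

variable (ha : ∀ j, a j ≠ 0)
include ha

theorem sum_mul_brieskornEuler (z : ι → ℂ) :
    ∑ j, (a j : ℂ) * z j ^ (a j - 1) * brieskornEuler a z j = 4 * ∑ j, z j ^ a j := by
  rw [Finset.mul_sum]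
  refine Finset.sum_congr rfl fun j _ => ?_
  have haj : (a j : ℂ) ≠ 0 := Nat.cast_ne_zero.2 (ha j)
  rw [← Nat.sub_add_cancel (Nat.one_le_iff_ne_zero.2 (ha j)), pow_succ, Nat.add_sub_cancel,
    Nat.sub_add_cancel (Nat.one_le_iff_ne_zero.2 (ha j)), brieskornEuler]
  field_simp

theorem fderiv_sqNorm_brieskornEuler_pos (hz : ∃ k, z k ≠ 0) :
    0 < fderiv ℝ sqNorm z (brieskornEuler a z) := by
  have hterm (j : ι) : (conj (z j) * brieskornEuler a z j).re =
      4 / (a j : ℝ) * Complex.normSq (z j) := by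
    rw [brieskornEuler, mul_left_comm, mul_comm (conj _), Complex.mul_conj]
    simp
  have hpos (j : ι) : (0 : ℝ) < 4 / a j :=
    div_pos four_pos (Nat.cast_pos.2 (Nat.pos_of_ne_zero (ha j)))
  obtain ⟨k, hk⟩ := hz
  simp only [fderiv_sqNorm, hterm]
  refine mul_pos two_pos (Finset.sum_pos' (fun j _ => ?_) ⟨k, Finset.mem_univ k, ?_⟩)
  · exact mul_nonneg (hpos j).le (Complex.normSq_nonneg _)
  · exact mul_pos (hpos k) (Complex.normSq_pos.2 hk)

theorem form_brieskornReeb (z : ι → ℂ) : (brieskorn a).form z (brieskornReeb a z) = sqNorm z := by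
  change brieskornForm a z (brieskornReeb a z) = sqNorm z
  rw [brieskornForm_apply, sqNorm, Finset.mul_sum]
  refine Finset.sum_congr rfl fun j _ => ?_
  have haj : (a j : ℝ) ≠ 0 := Nat.cast_ne_zero.2 (ha j)
  have hj : conj (z j) * brieskornReeb a z j =
      ((4 / a j * Complex.normSq (z j) : ℝ) : ℂ) * Complex.I := by
    push_cast
    rw [← Complex.mul_conj]
    simp only [brieskornReeb, brieskornEuler, Pi.smul_apply, smul_eq_mul]
    ring
  rw [hj, Complex.im_ofReal_mul, Complex.I_im]
  field_simp

theorem dform_brieskornReeb (x z w : ι → ℂ) :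
    (brieskorn a).dform x (brieskornReeb a z) w = -fderiv ℝ sqNorm z w := by
  rw [dform_brieskorn, brieskornForm_apply, fderiv_sqNorm, Finset.mul_sum, Finset.mul_sum,
    Finset.mul_sum, ← Finset.sum_neg_distrib]
  refine Finset.sum_congr rfl fun j _ => ?_
  have haj : (a j : ℝ) ≠ 0 := Nat.cast_ne_zero.2 (ha j)
  have hj : conj (brieskornReeb a z j) * w j =
      ((4 / a j : ℝ) : ℂ) * (-Complex.I * (conj (z j) * w j)) := by
    simp only [brieskornReeb, brieskornEuler, Pi.smul_apply, smul_eq_mul, map_mul, map_div₀,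
      Complex.conj_I, map_ofNat, map_natCast]
    push_cast
    ring
  rw [hj, Complex.im_ofReal_mul, neg_mul, Complex.neg_im, Complex.I_mul_im]
  field_simp

theorem brieskornReeb_mem_tangent (hz : z ∈ (brieskorn a).carrier) :
    brieskornReeb a z ∈ (brieskorn a).tangent z := by
  refine mem_brieskorn_tangent.2 ⟨?_, ?_⟩
  · rw [← neg_eq_zero, ← dform_brieskornReeb ha z, dform_brieskorn, mul_eq_zero]
    have h := brieskornForm_swap a (brieskornReeb a z) (brieskornReeb a z)
    exact Or.inr (by linarith)
  · simp only [brieskornReeb, Pi.smul_apply, mul_smul_comm]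
    rw [← Finset.smul_sum, sum_mul_brieskornEuler ha, (mem_brieskorn_carrier.1 hz).2, mul_zero,
      smul_zero]

theorem surjective_fderiv_brieskorn_constraint (hz : z ∈ (brieskorn a).carrier) :
    Function.Surjective (fderiv ℝ (brieskorn a).constraint z) := by
  classical
  obtain ⟨k, hk⟩ := exists_ne_zero_of_mem_brieskorn_carrier hz
  have hE := fderiv_sqNorm_brieskornEuler_pos ha ⟨k, hk⟩
  rintro ⟨s, c⟩
  let w : ι → ℂ := Pi.single k (c / (a k * z k ^ (a k - 1)))
  have hw : ∑ j, (a j : ℂ) * z j ^ (a j - 1) * w j = c := by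
    rw [Finset.sum_eq_single k (fun j _ hj => by simp [w, hj]) (by simp)]
    simp only [w, Pi.single_eq_same]
    rw [mul_div_cancel₀ _ (mul_ne_zero (Nat.cast_ne_zero.2 (ha k)) (pow_ne_zero _ hk))]
  refine ⟨w + ((s - fderiv ℝ sqNorm z w) / fderiv ℝ sqNorm z (brieskornEuler a z)) •
    brieskornEuler a z, ?_⟩
  rw [map_add, map_smul, fderiv_brieskorn_constraint, fderiv_brieskorn_constraint, hw,
    sum_mul_brieskornEuler ha, (mem_brieskorn_carrier.1 hz).2]
  ext1
  · simp [div_mul_cancel₀ _ hE.ne']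
  · simp

theorem finrank_brieskorn_tangent (hz : z ∈ (brieskorn a).carrier) :
    finrank ℝ ((brieskorn a).tangent z) + 3 = 2 * Fintype.card ι := by
  have h := LinearMap.finrank_range_add_finrank_ker
    (fderiv ℝ (brieskorn a).constraint z : (ι → ℂ) →ₗ[ℝ] ℝ × ℂ)
  rw [LinearMap.range_eq_top.2 (surjective_fderiv_brieskorn_constraint ha hz), finrank_top,
    finrank_prod, finrank_self, Complex.finrank_real_complex, finrank_pi_fintype,
    Finset.sum_const, Complex.finrank_real_complex, Finset.card_univ, smul_eq_mul] at h
  rw [mul_comm, ← h, add_comm]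
  rfl

theorem eq_zero_of_brieskornForm_I_smul_eq_zero {y : ι → ℂ}
    (hy : brieskornForm a y (Complex.I • y) = 0) : y = 0 := by
  have hterm (j : ι) : (a j : ℝ) * (conj (y j) * (Complex.I • y) j).im =
      a j * Complex.normSq (y j) := by
    rw [Pi.smul_apply, smul_eq_mul, mul_left_comm, Complex.I_mul_im,
      ← Complex.normSq_eq_conj_mul_self, Complex.ofReal_re]
  rw [brieskornForm_apply] at hy
  have hsum : ∑ j, (a j : ℝ) * Complex.normSq (y j) = 0 := by
    simp only [hterm] at hy
    linarith
  ext j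
  have hj := (Finset.sum_eq_zero_iff_of_nonneg fun j _ =>
    mul_nonneg (Nat.cast_nonneg (a j)) (Complex.normSq_nonneg (y j))).1 hsum j (Finset.mem_univ j)
  exact Complex.normSq_eq_zero.1 ((mul_eq_zero.1 hj).resolve_left (Nat.cast_ne_zero.2 (ha j)))

theorem brieskornForm_eq_zero_of_dform_horizontal_eq_zero (hz : z ∈ (brieskorn a).carrier)
    (hv : v ∈ (brieskorn a).tangent z)
    (hvw : ∀ w ∈ (brieskorn a).tangent z, (brieskorn a).form z w = 0 →
      (brieskorn a).dform z v w = 0) {w : ι → ℂ} (hw : w ∈ (brieskorn a).tangent z) :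
    brieskornForm a v w = 0 := by
  have hαZ : (brieskorn a).form z (brieskornReeb a z) = 1 := by
    rw [form_brieskornReeb ha, (mem_brieskorn_carrier.1 hz).1]
  have hvZ : brieskornForm a v (brieskornReeb a z) = 0 := by
    have h := dform_brieskornReeb ha z z v
    rw [(mem_brieskorn_tangent.1 hv).1, dform_brieskorn, brieskornForm_swap] at h
    linarith
  have h := hvw (w - (brieskorn a).form z w • brieskornReeb a z)
    (Submodule.sub_mem _ hw (Submodule.smul_mem _ _ (brieskornReeb_mem_tangent ha hz)))
    (by simp [hαZ])
  rw [dform_brieskorn, map_sub, map_smul, hvZ, smul_zero, sub_zero] at h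
  linarith

theorem exists_I_smul_add_smul_brieskornReeb_mem_tangent (hz : z ∈ (brieskorn a).carrier)
    (hv : v ∈ (brieskorn a).tangent z) :
    ∃ c : ℝ, Complex.I • (v + c • brieskornReeb a z) ∈ (brieskorn a).tangent z := by
  have hE := fderiv_sqNorm_brieskornEuler_pos ha (exists_ne_zero_of_mem_brieskorn_carrier hz)
  let c : ℝ := fderiv ℝ sqNorm z (Complex.I • v) / fderiv ℝ sqNorm z (brieskornEuler a z)
  have hy : v + c • brieskornReeb a z ∈ (brieskorn a).tangent z :=
    Submodule.add_mem _ hv (Submodule.smul_mem _ _ (brieskornReeb_mem_tangent ha hz))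
  refine ⟨c, mem_brieskorn_tangent.2 ⟨?_, ?_⟩⟩
  · have hIZ : Complex.I • brieskornReeb a z = -brieskornEuler a z := by
      rw [brieskornReeb, smul_smul, Complex.I_mul_I, neg_one_smul]
    rw [smul_add, smul_comm, hIZ, map_add, (fderiv ℝ sqNorm z).map_smul, map_neg, smul_eq_mul,
      mul_neg, div_mul_cancel₀ _ hE.ne', add_neg_cancel]
  · simp only [Pi.smul_apply Complex.I, mul_smul_comm]
    rw [← Finset.smul_sum, (mem_brieskorn_tangent.1 hy).2, smul_zero]

/-- Correcting `v` by a multiple of the Reeb vector makes `i v` tangent, and `dα` is positive on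
complex lines. -/
theorem brieskorn_nondegenerate (hz : z ∈ (brieskorn a).carrier)
    (hv : v ∈ (brieskorn a).tangent z) (hv0 : (brieskorn a).form z v = 0)
    (hvw : ∀ w ∈ (brieskorn a).tangent z, (brieskorn a).form z w = 0 →
      (brieskorn a).dform z v w = 0) : v = 0 := by
  obtain ⟨c, hIy⟩ := exists_I_smul_add_smul_brieskornReeb_mem_tangent ha hz hv
  have hy : v + c • brieskornReeb a z = 0 := by
    refine eq_zero_of_brieskornForm_I_smul_eq_zero ha ?_
    have hZy := dform_brieskornReeb ha z z (Complex.I • (v + c • brieskornReeb a z))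
    rw [dform_brieskorn, (mem_brieskorn_tangent.1 hIy).1, neg_zero, mul_eq_zero] at hZy
    rw [(isLinearMap_brieskornForm a).map_add, (isLinearMap_brieskornForm a).map_smul,
      _root_.add_apply, _root_.smul_apply,
      brieskornForm_eq_zero_of_dform_horizontal_eq_zero ha hz hv hvw hIy,
      hZy.resolve_left two_ne_zero, smul_zero, add_zero]
  have hc : c = 0 := by
    have h := congrArg ((brieskorn a).form z) hy
    rwa [map_add, hv0, map_smul, form_brieskornReeb ha, (mem_brieskorn_carrier.1 hz).1,
      smul_eq_mul, mul_one, zero_add, map_zero] at h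
  rwa [hc, zero_smul, add_zero] at hy

theorem isContact_brieskorn {N : ℕ} (hN : Fintype.card ι = N + 2) : (brieskorn a).IsContact N where
  smooth_constraint := contDiff_brieskorn_constraint a
  smooth_form := contDiff_brieskornForm a
  regular _ hz := surjective_fderiv_brieskorn_constraint ha hz
  dimension z hz := by
    have h := finrank_brieskorn_tangent ha hz
    omega
  form_ne_zero z hz := ⟨brieskornReeb a z, brieskornReeb_mem_tangent ha hz, by
    rw [form_brieskornReeb ha, (mem_brieskorn_carrier.1 hz).1]
    exact one_ne_zero⟩
  nondegenerate _ hz _ hv hv0 hvw := brieskorn_nondegenerate ha hz hv hv0 hvw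

end NonzeroExponents

end Brieskorn

section DiagonalCoordinates

open ComplexConjugate

variable {m p : ℕ} {z w : Fin (2 * m + 2) → ℂ}

/-- The coordinates of `ℂ ^ (2 m + 2)` regarded as `z₀`, `z₁` and `m` pairs. -/
def pairIndexEquiv (m : ℕ) : Fin 2 ⊕ Fin m × Fin 2 ≃ Fin (2 * m + 2) :=
  ((Equiv.sumCongr (Equiv.refl _) finProdFinEquiv).trans finSumFinEquiv).trans
    (finCongr (by ring))

/-- The indices of the coordinates diagonalizing the flows of the `g_j`: `inl 0` and `inl 1` for
`z₀` and `z₁`, `inr (inl j)` and `inr (inr j)` for `z_{2j} ± i z_{2j+1}`. -/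
abbrev DiagonalIndex (m : ℕ) : Type := Fin 2 ⊕ Fin m ⊕ Fin m

/-- The index of `z_{2j}`; as in `ustilovskyG`, `j : Fin m` stands for `j + 1`. -/
def fstIdx (j : Fin m) : Fin (2 * m + 2) := ⟨2 * (j + 1), by omega⟩

/-- The index of `z_{2j+1}`; as in `ustilovskyG`, `j : Fin m` stands for `j + 1`. -/
def sndIdx (j : Fin m) : Fin (2 * m + 2) := ⟨2 * (j + 1) + 1, by omega⟩

theorem fstIdx_ne_zero (j : Fin m) : fstIdx j ≠ 0 :=
  Fin.ne_of_val_ne (by simp [fstIdx])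

theorem sndIdx_ne_zero (j : Fin m) : sndIdx j ≠ 0 :=
  Fin.ne_of_val_ne (by simp [sndIdx])

theorem pairIndexEquiv_inl (i : Fin 2) : pairIndexEquiv m (Sum.inl i) = Fin.castLE (by omega) i :=
  Fin.ext rfl

theorem pairIndexEquiv_inr_zero (j : Fin m) : pairIndexEquiv m (Sum.inr (j, 0)) = fstIdx j :=
  Fin.ext (show 2 + (0 + 2 * (j : ℕ)) = 2 * (j + 1) by ring)

theorem pairIndexEquiv_inr_one (j : Fin m) : pairIndexEquiv m (Sum.inr (j, 1)) = sndIdx j :=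
  Fin.ext (show 2 + (1 + 2 * (j : ℕ)) = 2 * (j + 1) + 1 by ring)

theorem forall_pairIndex {P : Fin (2 * m + 2) → Prop} :
    (∀ k, P k) ↔ P 0 ∧ P 1 ∧ ∀ j, P (fstIdx j) ∧ P (sndIdx j) := by
  rw [← (pairIndexEquiv m).forall_congr_right, Sum.forall, Prod.forall, Fin.forall_fin_two]
  simp only [Fin.forall_fin_two, pairIndexEquiv_inl, pairIndexEquiv_inr_zero,
    pairIndexEquiv_inr_one, and_assoc]
  rfl

theorem sum_pairIndex {A : Type*} [AddCommMonoid A] (f : Fin (2 * m + 2) → A) :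
    ∑ k, f k = f 0 + f 1 + ∑ j, (f (fstIdx j) + f (sndIdx j)) := by
  rw [← (pairIndexEquiv m).sum_comp, Fintype.sum_sum_type, Fintype.sum_prod_type]
  simp only [Fin.sum_univ_two, pairIndexEquiv_inl, pairIndexEquiv_inr_zero,
    pairIndexEquiv_inr_one]
  rfl

/-- The linear map underlying the coordinate change `diagonalCoords`. -/
def diagonalMap (m : ℕ) : (Fin (2 * m + 2) → ℂ) →ₗ[ℝ] DiagonalIndex m → ℂ where
  toFun z := Sum.elim ![z 0, z 1] (Sum.elim (fun j => z (fstIdx j) + Complex.I * z (sndIdx j))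
    fun j => z (fstIdx j) - Complex.I * z (sndIdx j))
  map_add' z w := by
    ext ((k : Fin 2) | j | j)
    · fin_cases k <;> rfl
    · simp only [Sum.elim_inr, Sum.elim_inl, Pi.add_apply]
      ring
    · simp only [Sum.elim_inr, Pi.add_apply]
      ring
  map_smul' c z := by
    ext ((k : Fin 2) | j | j)
    · fin_cases k <;> rfl
    · simp [mul_left_comm]
    · simp [mul_sub, mul_left_comm]

theorem injective_diagonalMap : Function.Injective (diagonalMap m) := by
  refine (injective_iff_map_eq_zero _).2 fun z hz => funext (forall_pairIndex.2 ⟨?_, ?_, ?_⟩)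
  · exact congrFun hz (Sum.inl 0)
  · exact congrFun hz (Sum.inl 1)
  · intro j
    have hu : z (fstIdx j) + Complex.I * z (sndIdx j) = 0 := congrFun hz (Sum.inr (Sum.inl j))
    have hv : z (fstIdx j) - Complex.I * z (sndIdx j) = 0 := congrFun hz (Sum.inr (Sum.inr j))
    have hI := Complex.I_sq
    refine ⟨?_, ?_⟩
    · rw [Pi.zero_apply]
      linear_combination (hu + hv) / 2
    · rw [Pi.zero_apply]
      linear_combination Complex.I / 2 * (hv - hu) + z (sndIdx j) * hI

/-- The coordinates `z₀`, `z₁`, `u_j = z_{2j} + i z_{2j+1}`, `v_j = z_{2j} - i z_{2j+1}`, in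
which `g_j = (|u_j|² - |v_j|²) / 2` and `z_{2j}² + z_{2j+1}² = u_j v_j`. -/
def diagonalCoords (m : ℕ) : (Fin (2 * m + 2) → ℂ) ≃L[ℝ] (DiagonalIndex m → ℂ) :=
  (LinearMap.linearEquivOfInjective (diagonalMap m) injective_diagonalMap
    (by
      simp only [finrank_pi_fintype, Complex.finrank_real_complex, Finset.sum_const,
        Finset.card_univ, Fintype.card_fin, Fintype.card_sum, smul_eq_mul]
      ring)).toContinuousLinearEquiv

theorem diagonalCoords_inl_zero : diagonalCoords m z (Sum.inl 0) = z 0 := rfl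

theorem diagonalCoords_inl_one : diagonalCoords m z (Sum.inl 1) = z 1 := rfl

theorem diagonalCoords_inr_inl (j : Fin m) :
    diagonalCoords m z (Sum.inr (Sum.inl j)) = z (fstIdx j) + Complex.I * z (sndIdx j) := rfl

theorem diagonalCoords_inr_inr (j : Fin m) :
    diagonalCoords m z (Sum.inr (Sum.inr j)) = z (fstIdx j) - Complex.I * z (sndIdx j) := rfl

end DiagonalCoordinates

section TorusHamiltonian

open ComplexConjugate

variable {m p : ℕ} {z w : Fin (2 * m + 2) → ℂ}

/-- The weights of the form `α` in the diagonal coordinates. -/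
def diagonalMass (p : ℕ) : DiagonalIndex m → ℝ := Sum.elim ![p, 2] 1

theorem sum_diagonalMass_mul_conj_mul (z w : Fin (2 * m + 2) → ℂ) :
    ∑ k, (diagonalMass p k : ℂ) * (conj (diagonalCoords m z k) * diagonalCoords m w k) =
      ∑ k, ((if k = 0 then p else 2 : ℕ) : ℂ) * (conj (z k) * w k) := by
  have hI := Complex.I_sq
  rw [sum_pairIndex, Fintype.sum_sum_type, Fintype.sum_sum_type, Fin.sum_univ_two,
    ← Finset.sum_add_distrib]
  refine congrArg₂ (· + ·) rfl (Finset.sum_congr rfl fun j _ => ?_)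
  simp only [diagonalMass, Sum.elim_inr, Pi.one_apply, Complex.ofReal_one, one_mul,
    diagonalCoords_inr_inl, diagonalCoords_inr_inr, map_add, map_sub, map_mul, Complex.conj_I,
    fstIdx_ne_zero, sndIdx_ne_zero, if_false, Nat.cast_ofNat]
  linear_combination (-2) * conj (z (sndIdx j)) * w (sndIdx j) * hI

theorem ustilovsky_form_apply (z w : Fin (2 * m + 2) → ℂ) : (ustilovsky m p).form z w =
    1 / 4 * ∑ k, diagonalMass p k * (conj (diagonalCoords m z k) * diagonalCoords m w k).im := by
  have h := congrArg Complex.im (sum_diagonalMass_mul_conj_mul (p := p) z w)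
  simp only [Complex.im_sum, Complex.im_ofReal_mul, ← Complex.ofReal_natCast] at h
  rw [h]
  exact brieskornForm_apply (fun k => if k = 0 then p else 2) z w

theorem ustilovsky_dform_apply (x v w : Fin (2 * m + 2) → ℂ) : (ustilovsky m p).dform x v w =
    1 / 2 * ∑ k, diagonalMass p k * (conj (diagonalCoords m v k) * diagonalCoords m w k).im := by
  rw [ustilovsky, dform_brieskorn]
  change 2 * (ustilovsky m p).form v w = _
  rw [ustilovsky_form_apply]
  ring

/-- The polynomial `∑ z_j ^ a_j` in the diagonal coordinates. -/
def ustilovskyPoly (p : ℕ) (Z : DiagonalIndex m → ℂ) : ℂ :=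
  Z (.inl 0) ^ p + Z (.inl 1) ^ 2 + ∑ j, Z (.inr (.inl j)) * Z (.inr (.inr j))

theorem sum_pow_eq_ustilovskyPoly (z : Fin (2 * m + 2) → ℂ) :
    ∑ k, z k ^ (if k = 0 then p else 2) = ustilovskyPoly p (diagonalCoords m z) := by
  rw [sum_pairIndex, ustilovskyPoly]
  refine congrArg₂ (· + ·) rfl (Finset.sum_congr rfl fun j _ => ?_)
  simp only [fstIdx_ne_zero, sndIdx_ne_zero, if_false, diagonalCoords_inr_inl,
    diagonalCoords_inr_inr]
  linear_combination z (sndIdx j) ^ 2 * Complex.I_sq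

theorem mem_ustilovsky_carrier : z ∈ (ustilovsky m p).carrier ↔
    sqNorm z = 1 ∧ ustilovskyPoly p (diagonalCoords m z) = 0 := by
  rw [ustilovsky, mem_brieskorn_carrier, sum_pow_eq_ustilovskyPoly]

/-- The exponents of the torus action in the diagonal coordinates: the first coordinate of the
torus acts by the Reeb flow, the others by the contact flows of the `g_j`. -/
def torusWeight (p : ℕ) : DiagonalIndex m → (Fin (m + 1) → ℝ) →L[ℝ] ℝ :=
  Sum.elim ![(4 / p : ℝ) • .proj 0, (2 : ℝ) • .proj 0] (Sum.elim
    (fun j => (2 : ℝ) • (.proj 0 + .proj j.succ)) fun j => (2 : ℝ) • (.proj 0 - .proj j.succ))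

theorem torusWeight_inl_zero (v : Fin (m + 1) → ℝ) :
    torusWeight p (.inl 0) v = 4 / p * v 0 := rfl

theorem torusWeight_inl_one (v : Fin (m + 1) → ℝ) : torusWeight p (.inl 1) v = 2 * v 0 := rfl

theorem torusWeight_inr_inl (j : Fin m) (v : Fin (m + 1) → ℝ) :
    torusWeight p (.inr (.inl j)) v = 2 * (v 0 + v j.succ) := rfl

theorem torusWeight_inr_inr (j : Fin m) (v : Fin (m + 1) → ℝ) :
    torusWeight p (.inr (.inr j)) v = 2 * (v 0 - v j.succ) := rfl

/-- The contact Hamiltonian of the one-parameter subgroup `v` of the torus. -/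
def torusHamiltonian (v : Fin (m + 1) → ℝ) (z : Fin (2 * m + 2) → ℂ) : ℝ :=
  v 0 * sqNorm z + ∑ j : Fin m, v j.succ * ustilovskyG j z

theorem torusHamiltonian_eq_sum (hp : p ≠ 0) (v : Fin (m + 1) → ℝ) (z : Fin (2 * m + 2) → ℂ) :
    torusHamiltonian v z = ∑ k, diagonalMass p k / 4 * torusWeight p k v *
      Complex.normSq (diagonalCoords m z k) := by
  rw [torusHamiltonian, sqNorm, sum_pairIndex, Fintype.sum_sum_type, Fintype.sum_sum_type,
    Fin.sum_univ_two, ← Finset.sum_add_distrib, mul_add, add_assoc, Finset.mul_sum,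
    ← Finset.sum_add_distrib]
  congr 1
  · simp only [diagonalMass, torusWeight_inl_zero, torusWeight_inl_one, Sum.elim_inl,
      Matrix.cons_val_zero, Matrix.cons_val_one, diagonalCoords_inl_zero, diagonalCoords_inl_one]
    field_simp
    ring
  · refine Finset.sum_congr rfl fun j _ => ?_
    change _ + v j.succ * (2 * ((z (fstIdx j)).im * (z (sndIdx j)).re -
      (z (sndIdx j)).im * (z (fstIdx j)).re)) = _
    simp only [diagonalMass, torusWeight_inr_inl, torusWeight_inr_inr, Complex.normSq_apply,
      Sum.elim_inr, Pi.one_apply, diagonalCoords_inr_inl, diagonalCoords_inr_inr, Complex.add_re,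
      Complex.add_im, Complex.sub_re, Complex.sub_im, Complex.I_mul_re, Complex.I_mul_im]
    ring

theorem fderiv_ustilovsky_constraint (z w : Fin (2 * m + 2) → ℂ) :
    fderiv ℝ (ustilovsky m p).constraint z w = (fderiv ℝ sqNorm z w,
      p * z 0 ^ (p - 1) * w 0 + 2 * z 1 * w 1 + ∑ j : Fin m,
        (diagonalCoords m z (.inr (.inl j)) * diagonalCoords m w (.inr (.inr j)) +
          diagonalCoords m z (.inr (.inr j)) * diagonalCoords m w (.inr (.inl j)))) := by
  rw [ustilovsky, fderiv_brieskorn_constraint, Prod.mk.injEq, sum_pairIndex]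
  refine ⟨rfl, congrArg₂ (· + ·) (by simp) (Finset.sum_congr rfl fun j _ => ?_)⟩
  simp only [fstIdx_ne_zero, sndIdx_ne_zero, if_false, diagonalCoords_inr_inl,
    diagonalCoords_inr_inr]
  push_cast
  linear_combination (2 * z (sndIdx j) * w (sndIdx j)) * Complex.I_sq

/-- The coordinate function `z ↦ diagonalCoords m z k` as a continuous linear form. -/
def diagonalCoord (k : DiagonalIndex m) : (Fin (2 * m + 2) → ℂ) →L[ℝ] ℂ :=
  (ContinuousLinearMap.proj k).comp (diagonalCoords m).toContinuousLinearMap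

theorem hasFDerivAt_normSq_diagonalCoords (k : DiagonalIndex m) (z : Fin (2 * m + 2) → ℂ) :
    HasFDerivAt (fun z => Complex.normSq (diagonalCoords m z k))
      ((2 : ℝ) • (innerSL ℝ (diagonalCoords m z k)).comp (diagonalCoord k)) z :=
  hasFDerivAt_normSq_apply (diagonalCoord k) z

theorem contDiff_normSq_diagonalCoords (k : DiagonalIndex m) :
    ContDiff ℝ ∞ fun z => Complex.normSq (diagonalCoords m z k) := by
  simp only [Complex.normSq_eq_norm_sq]
  exact ((contDiff_apply ℝ ℂ k).comp (diagonalCoords m).contDiff).norm_sq ℝ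

theorem fderiv_normSq_diagonalCoords (k : DiagonalIndex m) (z w : Fin (2 * m + 2) → ℂ) :
    fderiv ℝ (fun z => Complex.normSq (diagonalCoords m z k)) z w =
      2 * (conj (diagonalCoords m z k) * diagonalCoords m w k).re := by
  rw [(hasFDerivAt_normSq_diagonalCoords k z).fderiv]
  simp [diagonalCoord, mul_comm]

theorem contDiff_torusHamiltonian (v : Fin (m + 1) → ℝ) :
    ContDiff ℝ ∞ (torusHamiltonian v) := by
  rw [funext (torusHamiltonian_eq_sum one_ne_zero v)]
  exact ContDiff.sum fun k _ => contDiff_const.mul (contDiff_normSq_diagonalCoords k)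

theorem fderiv_torusHamiltonian (hp : p ≠ 0) (v : Fin (m + 1) → ℝ) (z w : Fin (2 * m + 2) → ℂ) :
    fderiv ℝ (torusHamiltonian v) z w = ∑ k, diagonalMass p k / 2 * torusWeight p k v *
      (conj (diagonalCoords m z k) * diagonalCoords m w k).re := by
  have h := HasFDerivAt.fun_sum (u := Finset.univ) fun k _ =>
    (hasFDerivAt_normSq_diagonalCoords k z).const_mul
      (diagonalMass p k / 4 * torusWeight p k v)
  rw [funext (torusHamiltonian_eq_sum hp v), h.fderiv, _root_.sum_apply]
  refine Finset.sum_congr rfl fun k _ => ?_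
  rw [_root_.smul_apply, ← (hasFDerivAt_normSq_diagonalCoords k z).fderiv,
    fderiv_normSq_diagonalCoords, smul_eq_mul]
  ring

end TorusHamiltonian

section TorusAction

open ComplexConjugate

variable {m p : ℕ} {z w : Fin (2 * m + 2) → ℂ}

/-- The linear action of `ℝ ^ (m + 1)` generated by the commuting contact flows of `1` (the Reeb
flow) and of the `g_j`. -/
def torusAction (p : ℕ) :
    AddChar (Fin (m + 1) → ℝ) ((Fin (2 * m + 2) → ℂ) →L[ℝ] (Fin (2 * m + 2) → ℂ)) where
  toFun t := (diagonalCoords m).symm.toContinuousLinearMap.comp (.pi fun k =>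
    (ContinuousLinearMap.mul ℝ ℂ (Complex.exp (torusWeight p k t * Complex.I))).comp
      (diagonalCoord k))
  map_zero_eq_one' := by
    ext1 z
    refine (diagonalCoords m).injective (funext fun k => ?_)
    simp [diagonalCoord]
  map_add_eq_mul' s t := by
    ext1 z
    refine (diagonalCoords m).injective (funext fun k => ?_)
    simp [diagonalCoord, add_mul, Complex.exp_add, mul_assoc]

theorem diagonalCoords_torusAction (t : Fin (m + 1) → ℝ) (z : Fin (2 * m + 2) → ℂ)
    (k : DiagonalIndex m) : diagonalCoords m (torusAction p t z) k =
      Complex.exp (torusWeight p k t * Complex.I) * diagonalCoords m z k :=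
  congrFun ((diagonalCoords m).apply_symm_apply _) k

/-- The value at `z` of the fundamental vector fields of the torus action. -/
def torusField (p : ℕ) (z : Fin (2 * m + 2) → ℂ) :
    (Fin (m + 1) → ℝ) →L[ℝ] (Fin (2 * m + 2) → ℂ) :=
  (diagonalCoords m).symm.toContinuousLinearMap.comp (.pi fun k =>
    (torusWeight p k).smulRight (Complex.I * diagonalCoords m z k))

theorem diagonalCoords_torusField (z : Fin (2 * m + 2) → ℂ) (v : Fin (m + 1) → ℝ)
    (k : DiagonalIndex m) : diagonalCoords m (torusField p z v) k =
      torusWeight p k v * (Complex.I * diagonalCoords m z k) := by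
  rw [← Complex.real_smul]
  exact congrFun ((diagonalCoords m).apply_symm_apply _) k

theorem conj_mul_torusField (z : Fin (2 * m + 2) → ℂ) (v : Fin (m + 1) → ℝ)
    (k : DiagonalIndex m) :
    conj (diagonalCoords m z k) * diagonalCoords m (torusField p z v) k =
      ((torusWeight p k v * Complex.normSq (diagonalCoords m z k) : ℝ) : ℂ) * Complex.I := by
  rw [diagonalCoords_torusField, Complex.ofReal_mul, Complex.normSq_eq_conj_mul_self]
  ring

theorem torusAction_torusField (t v : Fin (m + 1) → ℝ) (z : Fin (2 * m + 2) → ℂ) :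
    torusAction p t (torusField p z v) = torusField p (torusAction p t z) v := by
  refine (diagonalCoords m).injective (funext fun k => ?_)
  simp only [diagonalCoords_torusAction, diagonalCoords_torusField]
  ring

theorem contDiff_torusAction_apply (z : Fin (2 * m + 2) → ℂ) :
    ContDiff ℝ ∞ fun t => torusAction p t z := by
  refine (diagonalCoords m).symm.contDiff.comp (contDiff_pi.2 fun k => ?_)
  exact ((Complex.ofRealCLM.contDiff.comp (torusWeight p k).contDiff).mul
    contDiff_const).cexp.mul contDiff_const

theorem hasFDerivAt_torusAction_apply (z : Fin (2 * m + 2) → ℂ) (t : Fin (m + 1) → ℝ) :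
    HasFDerivAt (fun t => torusAction p t z) (torusField p (torusAction p t z)) t := by
  refine (diagonalCoords m).symm.hasFDerivAt.comp t (hasFDerivAt_pi.2 fun k => ?_)
  have hw : HasFDerivAt (fun t => (torusWeight p k t : ℂ) * Complex.I) _ t :=
    (Complex.ofRealCLM.hasFDerivAt.comp t (torusWeight p k).hasFDerivAt).mul_const Complex.I
  refine (hw.cexp.mul_const (diagonalCoords m z k)).congr_fderiv ?_
  ext1 v
  rw [diagonalCoords_torusAction]
  simp only [_root_.smul_apply, ContinuousLinearMap.comp_apply, Complex.ofRealCLM_apply,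
    smul_eq_mul, ContinuousLinearMap.smulRight_apply, Complex.real_smul]
  ring

theorem hasStrictFDerivAt_torusAction_apply (z : Fin (2 * m + 2) → ℂ) (t : Fin (m + 1) → ℝ) :
    HasStrictFDerivAt (fun t => torusAction p t z) (torusField p (torusAction p t z)) t :=
  (contDiff_torusAction_apply z).contDiffAt.hasStrictFDerivAt'
    (hasFDerivAt_torusAction_apply z t) (by simp)

theorem exists_torusWeight_single_eq (hp : p ≠ 0) (i : Fin (m + 1)) (k : DiagonalIndex m) :
    ∃ n : ℤ, torusWeight p k (Pi.single i (p * Real.pi)) = n * (2 * Real.pi) := by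
  have hp' : (p : ℝ) ≠ 0 := Nat.cast_ne_zero.2 hp
  let c : Fin (m + 1) → ℤ := Pi.single i 1
  have hc (l : Fin (m + 1)) :
      (Pi.single i (p * Real.pi) : Fin (m + 1) → ℝ) l = c l * (p * Real.pi) := by
    simp [c, Pi.single_apply]
  rcases k with (k : Fin 2) | j | j
  · fin_cases k
    · refine ⟨2 * c 0, (torusWeight_inl_zero _).trans ?_⟩
      rw [hc]
      push_cast
      field_simp
      ring
    · refine ⟨p * c 0, (torusWeight_inl_one _).trans ?_⟩
      rw [hc]
      push_cast
      ring
  · refine ⟨p * (c 0 + c j.succ), ?_⟩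
    rw [torusWeight_inr_inl, hc, hc]
    push_cast
    ring
  · refine ⟨p * (c 0 - c j.succ), ?_⟩
    rw [torusWeight_inr_inr, hc, hc]
    push_cast
    ring

theorem torusAction_single_period (hp : p ≠ 0) (i : Fin (m + 1)) (z : Fin (2 * m + 2) → ℂ) :
    torusAction p (Pi.single i (p * Real.pi)) z = z := by
  refine (diagonalCoords m).injective (funext fun k => ?_)
  obtain ⟨n, hn⟩ := exists_torusWeight_single_eq hp i k
  rw [diagonalCoords_torusAction, hn, Complex.exp_eq_one_iff.2 ⟨n, by push_cast; ring⟩, one_mul]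

theorem fderiv_torusHamiltonian_torusField (hp : p ≠ 0) (v v' : Fin (m + 1) → ℝ)
    (z : Fin (2 * m + 2) → ℂ) :
    fderiv ℝ (torusHamiltonian v) z (torusField p z v') = 0 := by
  rw [fderiv_torusHamiltonian hp]
  refine Finset.sum_eq_zero fun k _ => ?_
  rw [conj_mul_torusField, Complex.re_ofReal_mul, Complex.I_re, mul_zero, mul_zero]

theorem torusHamiltonian_single_zero :
    torusHamiltonian (Pi.single 0 1 : Fin (m + 1) → ℝ) = sqNorm := by
  ext z
  simp [torusHamiltonian]

theorem torusHamiltonian_single_succ (j : Fin m) :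
    torusHamiltonian (Pi.single j.succ 1 : Fin (m + 1) → ℝ) = ustilovskyG j := by
  ext z
  simp [torusHamiltonian, Pi.single_apply]

theorem torusHamiltonian_cons_one (ε : Fin m → ℝ) :
    torusHamiltonian (Fin.cons 1 ε : Fin (m + 1) → ℝ) = ustilovskyH ε := by
  ext z
  simp [torusHamiltonian, ustilovskyH]

theorem ustilovsky_form_torusField (hp : p ≠ 0) (z : Fin (2 * m + 2) → ℂ) (v : Fin (m + 1) → ℝ) :
    (ustilovsky m p).form z (torusField p z v) = torusHamiltonian v z := by
  rw [ustilovsky_form_apply, torusHamiltonian_eq_sum hp, Finset.mul_sum]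
  refine Finset.sum_congr rfl fun k _ => ?_
  rw [conj_mul_torusField, Complex.im_ofReal_mul, Complex.I_im]
  ring

theorem ustilovsky_dform_torusField (hp : p ≠ 0) (x z w : Fin (2 * m + 2) → ℂ)
    (v : Fin (m + 1) → ℝ) : (ustilovsky m p).dform x (torusField p z v) w =
      -fderiv ℝ (torusHamiltonian v) z w := by
  rw [ustilovsky_dform_apply, fderiv_torusHamiltonian hp, Finset.mul_sum,
    ← Finset.sum_neg_distrib]
  refine Finset.sum_congr rfl fun k _ => ?_
  rw [diagonalCoords_torusField, map_mul, map_mul, Complex.conj_ofReal, Complex.conj_I, mul_assoc,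
    Complex.im_ofReal_mul, mul_assoc, neg_mul, Complex.neg_im, Complex.I_mul_im]
  ring

theorem torusField_mem_tangent (hp : p ≠ 0) (hz : z ∈ (ustilovsky m p).carrier)
    (v : Fin (m + 1) → ℝ) : torusField p z v ∈ (ustilovsky m p).tangent z := by
  have hp' : (p : ℂ) ≠ 0 := Nat.cast_ne_zero.2 hp
  have hpoly := (mem_ustilovsky_carrier.1 hz).2
  rw [FormOnLevelSet.tangent, LinearMap.mem_ker, ContinuousLinearMap.coe_coe,
    fderiv_ustilovsky_constraint, Prod.mk_eq_zero]
  constructor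
  · rw [← torusHamiltonian_single_zero, fderiv_torusHamiltonian_torusField hp]
  · rw [← mul_zero (4 * Complex.I * v 0), ← hpoly, ustilovskyPoly, mul_add, Finset.mul_sum]
    refine congrArg₂ (· + ·) ?_ (Finset.sum_congr rfl fun j _ => ?_)
    · have h0 : torusField p z v 0 = (4 / p * v 0 : ℝ) * (Complex.I * z 0) :=
        diagonalCoords_torusField z v (.inl 0)
      have h1 : torusField p z v 1 = (2 * v 0 : ℝ) * (Complex.I * z 1) :=
        diagonalCoords_torusField z v (.inl 1)
      rw [h0, h1, diagonalCoords_inl_zero, diagonalCoords_inl_one, ← mul_pow_sub_one hp (z 0)]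
      push_cast
      field_simp
      ring
    · simp only [diagonalCoords_torusField, torusWeight_inr_inl, torusWeight_inr_inr]
      push_cast
      ring

section ContactField

variable (hp : p ≠ 0) (hz : z ∈ (ustilovsky m p).carrier)
include hp

theorem isContact_ustilovsky : (ustilovsky m p).IsContact (2 * m) :=
  isContact_brieskorn (fun j => by split_ifs <;> [exact hp; exact two_ne_zero]) (by simp)

include hz

theorem contactField_torusHamiltonian (v : Fin (m + 1) → ℝ) :
    (ustilovsky m p).contactField (torusHamiltonian v) z = torusField p z v :=
  (isContact_ustilovsky hp).contactField_eq_of_dform_eq hz (torusField_mem_tangent hp hz v)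
    (ustilovsky_form_torusField hp z v) fun w _ => ustilovsky_dform_torusField hp z z w v

theorem reeb_ustilovsky : (ustilovsky m p).reeb z = torusField p z (Pi.single 0 1) := by
  refine (isContact_ustilovsky hp).reeb_eq hz ⟨torusField_mem_tangent hp hz _, ?_, fun w hw => ?_⟩
  · rw [ustilovsky_form_torusField hp, torusHamiltonian_single_zero,
      (mem_ustilovsky_carrier.1 hz).1]
  · rw [ustilovsky_dform_torusField hp, torusHamiltonian_single_zero,
      (mem_brieskorn_tangent.1 hw).1, neg_zero]

end ContactField

/-- Invariance under the torus action. -/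
def IsTorusInvariant (p : ℕ) (f : (Fin (2 * m + 2) → ℂ) → ℝ) : Prop :=
  ∀ t z, f (torusAction p t z) = f z

theorem IsTorusInvariant.fderiv_torusField {f : (Fin (2 * m + 2) → ℂ) → ℝ}
    (hf : IsTorusInvariant p f) (hd : Differentiable ℝ f) (z : Fin (2 * m + 2) → ℂ)
    (v : Fin (m + 1) → ℝ) : fderiv ℝ f z (torusField p z v) = 0 := by
  have h := (hd (torusAction p 0 z)).hasFDerivAt.comp 0 (hasFDerivAt_torusAction_apply z 0)
  rw [AddChar.map_zero_eq_one, one_apply_eq_self] at h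
  have hconst : HasFDerivAt (f ∘ fun t => torusAction p t z) 0 0 :=
    (hasFDerivAt_const (𝕜 := ℝ) (f z) 0).congr_of_eventuallyEq (.of_forall fun t => hf t z)
  exact DFunLike.congr_fun (h.unique hconst) v

end TorusAction

section GenericIndependence

open ComplexConjugate

variable {m p : ℕ} {k : Fin m} {z w : Fin (2 * m + 2) → ℂ}

/-- The product `u_j v_j`, equal to `z_{2j}² + z_{2j+1}²`. -/
def pairProduct (j : Fin m) (z : Fin (2 * m + 2) → ℂ) : ℂ :=
  diagonalCoords m z (.inr (.inl j)) * diagonalCoords m z (.inr (.inr j))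

/-- The invariants `Im (u_j v_j z̄₁²)` for `j ≠ k`, completed by `|z₁|²` in the place of `j = k`. -/
def pairPhase (k j : Fin m) (z : Fin (2 * m + 2) → ℂ) : ℝ :=
  if j = k then Complex.normSq (z 1) else (pairProduct j z * conj (z 1) ^ 2).im

/-- The general position in which the integrals are shown to be independent. -/
structure IsGeneric (p : ℕ) (k : Fin m) (z : Fin (2 * m + 2) → ℂ) : Prop where
  one_ne_zero : z 1 ≠ 0
  im_ne_zero : (conj (z 0 ^ p) * pairProduct k z).im ≠ 0
  re_ne_zero : ∀ j, j ≠ k → (pairProduct j z * conj (z 1) ^ 2).re ≠ 0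

theorem IsGeneric.pairProduct_ne_zero (hz : IsGeneric p k z) (j : Fin m) :
    pairProduct j z ≠ 0 := by
  intro h
  obtain rfl | hj := eq_or_ne j k
  · exact hz.im_ne_zero (by rw [h, mul_zero, Complex.zero_im])
  · exact hz.re_ne_zero j hj (by rw [h, zero_mul, Complex.zero_re])

theorem fderiv_pairPhase_self (k : Fin m) (z w : Fin (2 * m + 2) → ℂ) :
    fderiv ℝ (pairPhase k k) z w = 2 * (conj (z 1) * w 1).re := by
  simp only [funext fun z => show pairPhase k k z = _ from if_pos rfl]
  exact fderiv_normSq_diagonalCoords (.inl 1) z w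

theorem fderiv_pairPhase_of_ne {j : Fin m} (hj : j ≠ k) (z w : Fin (2 * m + 2) → ℂ) :
    fderiv ℝ (pairPhase k j) z w =
      ((diagonalCoords m z (.inr (.inl j)) * diagonalCoords m w (.inr (.inr j)) +
        diagonalCoords m z (.inr (.inr j)) * diagonalCoords m w (.inr (.inl j))) * conj (z 1) ^ 2 +
        2 * pairProduct j z * conj (z 1) * conj (w 1)).im := by
  have hu := (diagonalCoord (m := m) (.inr (.inl j))).hasFDerivAt (x := z)
  have hv := (diagonalCoord (m := m) (.inr (.inr j))).hasFDerivAt (x := z)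
  have hy := ((Complex.conjCLE : ℂ →L[ℝ] ℂ).comp
    (.proj (R := ℝ) (φ := fun _ : Fin (2 * m + 2) => ℂ) 1)).hasFDerivAt (x := z)
  have h := Complex.imCLM.hasFDerivAt.comp z ((hu.mul hv).mul (hy.pow 2))
  have heq : pairPhase k j = _ := funext fun z => if_neg hj
  rw [heq]
  refine (DFunLike.congr_fun h.fderiv w).trans ?_
  change Complex.im (pairProduct j z * ((2 • conj (z 1) ^ 1) * conj (w 1)) +
    conj (z 1) ^ 2 * (diagonalCoords m z (.inr (.inl j)) * diagonalCoords m w (.inr (.inr j)) +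
      diagonalCoords m z (.inr (.inr j)) * diagonalCoords m w (.inr (.inl j)))) = _
  refine congrArg Complex.im ?_
  rw [nsmul_eq_mul, Nat.cast_ofNat]
  ring

/-- The tangent vector at `z` moving only the diagonal coordinate `l`, with logarithmic
derivative `s`. -/
def coordinateVector (z : Fin (2 * m + 2) → ℂ) (l : DiagonalIndex m) (s : ℂ) :
    Fin (2 * m + 2) → ℂ :=
  (diagonalCoords m).symm (Pi.single l (s * diagonalCoords m z l))

theorem diagonalCoords_coordinateVector (z : Fin (2 * m + 2) → ℂ) (l l' : DiagonalIndex m)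
    (s : ℂ) : diagonalCoords m (coordinateVector z l s) l' =
      if l' = l then s * diagonalCoords m z l' else 0 := by
  rw [coordinateVector, ContinuousLinearEquiv.apply_symm_apply, Pi.single_apply]
  split_ifs with h <;> simp [h]

theorem coordinateVector_apply_zero (z : Fin (2 * m + 2) → ℂ) (l : DiagonalIndex m) (s : ℂ) :
    coordinateVector z l s 0 = if l = .inl 0 then s * z 0 else 0 := by
  simpa only [eq_comm, diagonalCoords_inl_zero] using diagonalCoords_coordinateVector z l (.inl 0) s

theorem coordinateVector_apply_one (z : Fin (2 * m + 2) → ℂ) (l : DiagonalIndex m) (s : ℂ) :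
    coordinateVector z l s 1 = if l = .inl 1 then s * z 1 else 0 := by
  simpa only [eq_comm, diagonalCoords_inl_one] using diagonalCoords_coordinateVector z l (.inl 1) s

theorem fderiv_torusHamiltonian_coordinateVector (hp : p ≠ 0) (v : Fin (m + 1) → ℝ)
    (z : Fin (2 * m + 2) → ℂ) (l : DiagonalIndex m) (s : ℂ) :
    fderiv ℝ (torusHamiltonian v) z (coordinateVector z l s) =
      diagonalMass p l / 2 * torusWeight p l v *
        (s.re * Complex.normSq (diagonalCoords m z l)) := by
  rw [fderiv_torusHamiltonian hp, Finset.sum_eq_single_of_mem l (Finset.mem_univ _)]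
  · rw [diagonalCoords_coordinateVector, if_pos rfl, mul_left_comm,
      ← Complex.normSq_eq_conj_mul_self, Complex.re_mul_ofReal]
  · intro l' _ hl
    rw [diagonalCoords_coordinateVector, if_neg hl, mul_zero, Complex.zero_re, mul_zero]

theorem fderiv_normSq_coordinateVector (z : Fin (2 * m + 2) → ℂ) (l l' : DiagonalIndex m) (s : ℂ) :
    fderiv ℝ (fun z => Complex.normSq (diagonalCoords m z l')) z (coordinateVector z l s) =
      if l' = l then 2 * (s.re * Complex.normSq (diagonalCoords m z l')) else 0 := by
  rw [fderiv_normSq_diagonalCoords, diagonalCoords_coordinateVector]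
  split_ifs
  · rw [mul_left_comm, ← Complex.normSq_eq_conj_mul_self, Complex.re_mul_ofReal]
  · rw [mul_zero, Complex.zero_re, mul_zero]

theorem fderiv_constraint_coordinateVector (hp : p ≠ 0) (z : Fin (2 * m + 2) → ℂ)
    (l : DiagonalIndex m) (s : ℂ) :
    (fderiv ℝ (ustilovsky m p).constraint z (coordinateVector z l s)).2 =
      s * Sum.elim ![p * z 0 ^ p, 2 * z 1 ^ 2]
        (Sum.elim (pairProduct · z) (pairProduct · z)) l := by
  rw [fderiv_ustilovsky_constraint]
  simp only [coordinateVector_apply_zero, coordinateVector_apply_one,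
    diagonalCoords_coordinateVector]
  obtain l | j | j := l
  · fin_cases l
    · simp [mul_left_comm _ s, mul_assoc, pow_sub_one_mul hp]
    · simpa using by ring
  · simpa [pairProduct] using by ring
  · simpa [pairProduct] using by ring

theorem fderiv_pairPhase_coordinateVector_inl_zero (k j : Fin m) (z : Fin (2 * m + 2) → ℂ) (s : ℂ) :
    fderiv ℝ (pairPhase k j) z (coordinateVector z (.inl 0) s) = 0 := by
  obtain rfl | hj := eq_or_ne j k
  · rw [fderiv_pairPhase_self, coordinateVector_apply_one]
    simp
  · rw [fderiv_pairPhase_of_ne hj]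
    simp [diagonalCoords_coordinateVector, coordinateVector_apply_one]

theorem fderiv_pairPhase_coordinateVector_inr_inl (k j i : Fin m) (z : Fin (2 * m + 2) → ℂ)
    (s : ℂ) : fderiv ℝ (pairPhase k j) z (coordinateVector z (.inr (.inl i)) s) =
      if i = j ∧ j ≠ k then (s * (pairProduct j z * conj (z 1) ^ 2)).im else 0 := by
  obtain rfl | hj := eq_or_ne j k
  · rw [fderiv_pairPhase_self, coordinateVector_apply_one]
    simp
  · rw [fderiv_pairPhase_of_ne hj]
    simp only [diagonalCoords_coordinateVector, coordinateVector_apply_one]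
    obtain rfl | hi := eq_or_ne i j
    · simpa [hj, pairProduct] using by ring
    · simp [hi, hi.symm]

theorem fderiv_pairPhase_coordinateVector_inl_one (k j : Fin m) (z : Fin (2 * m + 2) → ℂ) :
    fderiv ℝ (pairPhase k j) z (coordinateVector z (.inl 1) 1) =
      if j = k then 2 * Complex.normSq (z 1) else
        2 * (pairProduct j z * conj (z 1) ^ 2).im := by
  obtain rfl | hj := eq_or_ne j k
  · rw [fderiv_pairPhase_self, coordinateVector_apply_one, if_pos rfl, if_pos rfl, one_mul,
      ← Complex.normSq_eq_conj_mul_self, Complex.ofReal_re]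
  · rw [fderiv_pairPhase_of_ne hj, if_neg hj, ← Complex.im_ofReal_mul]
    refine congrArg Complex.im ?_
    simp only [diagonalCoords_coordinateVector, coordinateVector_apply_one, reduceCtorEq, if_true,
      if_false, one_mul, mul_zero, add_zero, zero_mul, zero_add, Complex.ofReal_ofNat]
    ring

/-- A linear relation at `z` between the differentials of the constraint, of the Hamiltonians of
the torus action, of the functions `|v_j|²` and of `pairPhase k`. -/
def IsConstraintRelation (p : ℕ) (k : Fin m) (z : Fin (2 * m + 2) → ℂ) (β : Fin (m + 1) → ℝ)
    (η τ : Fin m → ℝ) (μ : ℂ) : Prop :=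
  ∀ w, fderiv ℝ (torusHamiltonian β) z w +
      ∑ j, η j * fderiv ℝ (fun z => Complex.normSq (diagonalCoords m z (.inr (.inr j)))) z w +
      ∑ j, τ j * fderiv ℝ (pairPhase k j) z w =
    (μ * (fderiv ℝ (ustilovsky m p).constraint z w).2).re

namespace IsConstraintRelation

variable {β : Fin (m + 1) → ℝ} {η τ : Fin m → ℝ} {μ : ℂ}

theorem apply_inl_zero (h : IsConstraintRelation p k z β η τ μ) (hp : p ≠ 0) (s : ℂ) :
    2 * β 0 * (s.re * Complex.normSq (z 0)) = p * (μ * (s * z 0 ^ p)).re := by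
  have h0 := h (coordinateVector z (.inl 0) s)
  have hp' : (p : ℝ) ≠ 0 := Nat.cast_ne_zero.2 hp
  simp only [fderiv_torusHamiltonian_coordinateVector hp, fderiv_normSq_coordinateVector,
    fderiv_pairPhase_coordinateVector_inl_zero, fderiv_constraint_coordinateVector hp,
    reduceCtorEq, if_false, mul_zero, Finset.sum_const_zero, add_zero, diagonalMass,
    torusWeight_inl_zero, diagonalCoords_inl_zero, Sum.elim_inl, Matrix.cons_val_zero] at h0
  rw [← Complex.re_ofReal_mul, Complex.ofReal_natCast, mul_left_comm (p : ℂ),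
    mul_left_comm (p : ℂ), ← h0]
  field_simp
  ring

theorem apply_inl_one (h : IsConstraintRelation p k z β η τ μ) (hp : p ≠ 0) :
    2 * β 0 * Complex.normSq (z 1) + ∑ j, τ j * (if j = k then 2 * Complex.normSq (z 1) else
        2 * (pairProduct j z * conj (z 1) ^ 2).im) = (μ * (2 * z 1 ^ 2)).re := by
  have h0 := h (coordinateVector z (.inl 1) 1)
  simp only [fderiv_torusHamiltonian_coordinateVector hp, fderiv_normSq_coordinateVector,
    fderiv_pairPhase_coordinateVector_inl_one, fderiv_constraint_coordinateVector hp,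
    reduceCtorEq, if_false, mul_zero, Finset.sum_const_zero, add_zero, diagonalMass,
    torusWeight_inl_one, diagonalCoords_inl_one, Sum.elim_inl, Matrix.cons_val_one,
    Matrix.cons_val_fin_one, one_mul, Complex.one_re, div_self (two_ne_zero' ℝ)] at h0
  exact h0

theorem apply_inr_inl (h : IsConstraintRelation p k z β η τ μ) (hp : p ≠ 0) (i : Fin m) (s : ℂ) :
    (β 0 + β i.succ) * (s.re * Complex.normSq (diagonalCoords m z (.inr (.inl i)))) +
        (if i = k then 0 else τ i * (s * (pairProduct i z * conj (z 1) ^ 2)).im) =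
      (μ * (s * pairProduct i z)).re := by
  have h0 := h (coordinateVector z (.inr (.inl i)) s)
  simp only [fderiv_torusHamiltonian_coordinateVector hp, fderiv_normSq_coordinateVector,
    fderiv_pairPhase_coordinateVector_inr_inl, fderiv_constraint_coordinateVector hp,
    reduceCtorEq, Sum.inr.injEq, if_false, mul_zero, Finset.sum_const_zero, add_zero,
    torusWeight_inr_inl, diagonalMass, Sum.elim_inr, Sum.elim_inl, Pi.one_apply] at h0
  rw [← h0, Finset.sum_eq_single_of_mem i (Finset.mem_univ i)
    fun j _ hj => by rw [if_neg fun hij => hj hij.1.symm, mul_zero]]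
  congr 1
  · ring
  · by_cases hi : i = k <;> simp [hi]

theorem mu_eq_zero (h : IsConstraintRelation p k z β η τ μ) (hp : p ≠ 0)
    (hz : IsGeneric p k z) : μ = 0 := by
  have h0 := h.apply_inl_zero hp Complex.I
  have hk := h.apply_inr_inl hp k Complex.I
  rw [if_pos rfl, add_zero] at hk
  rw [Complex.I_re, zero_mul, mul_zero, mul_left_comm, Complex.I_mul_re, eq_comm] at h0 hk
  have h0' := (mul_eq_zero.1 h0).resolve_left (Nat.cast_ne_zero.2 hp)
  exact eq_zero_of_im_mul_eq_zero (neg_eq_zero.1 h0') (neg_eq_zero.1 hk) hz.im_ne_zero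

theorem apply_zero_eq_zero (h : IsConstraintRelation p k z β η τ 0) (hp : p ≠ 0)
    (hz : IsGeneric p k z) : β 0 = 0 := by
  have h0 := h.apply_inl_zero hp 1
  have hz0 : z 0 ≠ 0 := fun h0 => hz.im_ne_zero (by simp [h0, hp])
  simpa [hz0] using h0

theorem apply_ne_eq_zero (h : IsConstraintRelation p k z β η τ 0) (hp : p ≠ 0)
    (hz : IsGeneric p k z) {j : Fin m} (hj : j ≠ k) : τ j = 0 := by
  have h0 := h.apply_inr_inl hp j Complex.I
  rw [if_neg hj, Complex.I_re, zero_mul, mul_zero, zero_add, zero_mul, Complex.zero_re,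
    Complex.I_mul_im] at h0
  exact (mul_eq_zero.1 h0).resolve_right (hz.re_ne_zero j hj)

theorem tau_eq_zero (h : IsConstraintRelation p k z β η τ 0) (hp : p ≠ 0)
    (hz : IsGeneric p k z) : τ = 0 := by
  have hk := h.apply_inl_one hp
  rw [h.apply_zero_eq_zero hp hz, Finset.sum_eq_single_of_mem k (Finset.mem_univ k)
    fun j _ hj => by rw [h.apply_ne_eq_zero hp hz hj, zero_mul]] at hk
  have hk' : τ k = 0 := by simpa [hz.one_ne_zero] using hk
  funext j
  obtain rfl | hj := eq_or_ne j k
  exacts [hk', h.apply_ne_eq_zero hp hz hj]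

theorem beta_eq_zero (h : IsConstraintRelation p k z β η τ 0) (hp : p ≠ 0)
    (hz : IsGeneric p k z) : β = 0 := by
  refine funext fun i => Fin.cases (h.apply_zero_eq_zero hp hz) (fun j => ?_) i
  have hj := h.apply_inr_inl hp j 1
  have hu : diagonalCoords m z (.inr (.inl j)) ≠ 0 :=
    left_ne_zero_of_mul (hz.pairProduct_ne_zero j)
  simpa [h.apply_zero_eq_zero hp hz, h.tau_eq_zero hp hz, hu] using hj

theorem eta_eq_zero (h : IsConstraintRelation p k z β η τ 0) (hp : p ≠ 0)
    (hz : IsGeneric p k z) : η = 0 := by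
  funext j
  have hj := h (coordinateVector z (.inr (.inr j)) 1)
  have hv : diagonalCoords m z (.inr (.inr j)) ≠ 0 :=
    right_ne_zero_of_mul (hz.pairProduct_ne_zero j)
  simpa [fderiv_torusHamiltonian_coordinateVector hp, fderiv_normSq_coordinateVector,
    h.beta_eq_zero hp hz, h.tau_eq_zero hp hz, hv] using hj

end IsConstraintRelation

theorem isLinearMap_fderiv_torusHamiltonian (z w : Fin (2 * m + 2) → ℂ) :
    IsLinearMap ℝ fun v => fderiv ℝ (torusHamiltonian v) z w := by
  constructor <;> intros <;>
    simp only [fderiv_torusHamiltonian one_ne_zero, map_add, map_smul, smul_eq_mul, mul_add,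
      add_mul, Finset.sum_add_distrib, Finset.mul_sum, mul_assoc, mul_left_comm]

/-- The integrals of the contact flow of `torusHamiltonian (Fin.cons 1 (b i))`: the Hamiltonians
of the torus action attached to the basis `b`, the functions `|v_j|²`, and `pairPhase k`. -/
def ustilovskyIntegral (b : Fin m → Fin m → ℝ) (k : Fin m) (q : Fin 3 × Fin m) :
    (Fin (2 * m + 2) → ℂ) → ℝ :=
  ![torusHamiltonian (Fin.cons 1 (b q.2)),
    fun z => Complex.normSq (diagonalCoords m z (.inr (.inr q.2))), pairPhase k q.2] q.1

/-- The functions `ustilovskyIntegral b k (i, j)` listed in the lexicographic order of `(i, j)`. -/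
def ustilovskyIntegrals (b : Fin m → Fin m → ℝ) (k : Fin m) (i : Fin (3 * m)) :
    (Fin (2 * m + 2) → ℂ) → ℝ :=
  ustilovskyIntegral b k (finProdFinEquiv.symm i)

theorem exists_isConstraintRelation {b : Fin m → Fin m → ℝ} {c : Fin 3 × Fin m → ℝ}
    (hc : ∀ w ∈ (ustilovsky m p).tangent z,
      ∑ q, c q * fderiv ℝ (ustilovskyIntegral b k q) z w = 0) :
    ∃ (l : ℝ) (μ : ℂ), IsConstraintRelation p k z
      (∑ j, c (0, j) • (Fin.cons 1 (b j) : Fin (m + 1) → ℝ) - l • Pi.single 0 1)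
      (fun j => c (1, j)) (fun j => c (2, j)) μ := by
  obtain ⟨f, hf⟩ := exists_eq_comp_of_ker_le_ker (l := ((∑ q, c q •
    fderiv ℝ (ustilovskyIntegral b k q) z : (Fin (2 * m + 2) → ℂ) →L[ℝ] ℝ) :
      (Fin (2 * m + 2) → ℂ) →ₗ[ℝ] ℝ)) (L := (fderiv ℝ (ustilovsky m p).constraint z).toLinearMap)
    fun w hw => by simpa [_root_.sum_apply] using hc w hw
  obtain ⟨l, μ, hl⟩ := exists_apply_eq_add_re_mul f
  refine ⟨l, μ, fun w => ?_⟩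
  have hfw : ∑ q, c q * fderiv ℝ (ustilovskyIntegral b k q) z w =
      f (fderiv ℝ (ustilovsky m p).constraint z w) := by
    simpa [_root_.sum_apply] using LinearMap.congr_fun hf w
  have hβ := (isLinearMap_fderiv_torusHamiltonian z w).mk'.map_sub
    (∑ j, c (0, j) • (Fin.cons 1 (b j) : Fin (m + 1) → ℝ)) (l • Pi.single 0 1)
  simp only [map_sum, map_smul, IsLinearMap.mk'_apply, smul_eq_mul,
    torusHamiltonian_single_zero] at hβ
  rw [fderiv_ustilovsky_constraint, hl, Fintype.sum_prod_type, Fin.sum_univ_three] at hfw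
  rw [hβ, fderiv_ustilovsky_constraint]
  simp only [ustilovskyIntegral, Matrix.cons_val_zero, Matrix.cons_val_one, Matrix.cons_val] at hfw
  linear_combination hfw

theorem independentAt_of_isGeneric {b : Fin m → Fin m → ℝ} (hb : LinearIndependent ℝ b)
    (hp : p ≠ 0) (hz : IsGeneric p k z) :
    (ustilovsky m p).IndependentAt (ustilovskyIntegrals b k) z := by
  refine (linearIndependent_equiv finProdFinEquiv.symm
    (f := fun q : Fin 3 × Fin m => (fderiv ℝ (ustilovskyIntegral b k q) z).toLinearMap ∘ₗ
      ((ustilovsky m p).tangent z).subtype)).2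
    (Fintype.linearIndependent_iff.2 fun c hc => ?_)
  have hc' : ∀ w ∈ (ustilovsky m p).tangent z,
      ∑ q, c q * fderiv ℝ (ustilovskyIntegral b k q) z w = 0 := fun w hw => by
    simpa using LinearMap.congr_fun hc ⟨w, hw⟩
  obtain ⟨l, μ, h⟩ := exists_isConstraintRelation hc'
  obtain rfl := h.mu_eq_zero hp hz
  have h0 : ∀ j, c (0, j) = 0 := by
    refine Fintype.linearIndependent_iff.1 hb _ (funext fun j => ?_)
    simpa using congr_fun (h.beta_eq_zero hp hz) j.succ
  rintro ⟨i, j⟩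
  fin_cases i
  exacts [h0 j, congr_fun (h.eta_eq_zero hp hz) j, congr_fun (h.tau_eq_zero hp hz) j]

theorem normSq_diagonalCoords_torusAction (t : Fin (m + 1) → ℝ) (z : Fin (2 * m + 2) → ℂ)
    (l : DiagonalIndex m) : Complex.normSq (diagonalCoords m (torusAction p t z) l) =
      Complex.normSq (diagonalCoords m z l) := by
  rw [diagonalCoords_torusAction, Complex.normSq_mul, Complex.normSq_eq_norm_sq,
    Complex.norm_exp_ofReal_mul_I, one_pow, one_mul]

theorem isTorusInvariant_torusHamiltonian (v : Fin (m + 1) → ℝ) :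
    IsTorusInvariant p (torusHamiltonian v) := fun t z => by
  simp only [torusHamiltonian_eq_sum one_ne_zero, normSq_diagonalCoords_torusAction]

theorem isTorusInvariant_pairPhase (k j : Fin m) : IsTorusInvariant p (pairPhase k j) := by
  intro t z
  have hy : torusAction p t z 1 = Complex.exp ((2 * t 0 : ℝ) * Complex.I) * z 1 :=
    diagonalCoords_torusAction t z (.inl 1)
  have hP : pairProduct j (torusAction p t z) =
      Complex.exp ((2 * t 0 : ℝ) * Complex.I) ^ 2 * pairProduct j z := by
    rw [pairProduct, diagonalCoords_torusAction, diagonalCoords_torusAction, mul_mul_mul_comm,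
      ← Complex.exp_add, ← Complex.exp_nat_mul, torusWeight_inr_inl, torusWeight_inr_inr]
    congr 2
    push_cast
    ring
  have hnorm : Complex.exp ((2 * t 0 : ℝ) * Complex.I) ^ 2 *
      conj (Complex.exp ((2 * t 0 : ℝ) * Complex.I)) ^ 2 = 1 := by
    rw [← mul_pow, Complex.mul_conj, Complex.normSq_eq_norm_sq, Complex.norm_exp_ofReal_mul_I]
    norm_num
  rw [pairPhase, pairPhase, hP, hy]
  split_ifs
  · rw [Complex.normSq_mul, Complex.normSq_eq_norm_sq, Complex.norm_exp_ofReal_mul_I, one_pow,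
      one_mul]
  · rw [map_mul, mul_pow, mul_mul_mul_comm, hnorm, one_mul]

theorem isTorusInvariant_ustilovskyIntegral (b : Fin m → Fin m → ℝ) (k : Fin m)
    (q : Fin 3 × Fin m) : IsTorusInvariant p (ustilovskyIntegral b k q) := by
  obtain ⟨i, j⟩ := q
  fin_cases i
  exacts [isTorusInvariant_torusHamiltonian _, fun t z => normSq_diagonalCoords_torusAction t z _,
    isTorusInvariant_pairPhase k j]

theorem contDiff_pairPhase (k j : Fin m) : ContDiff ℝ ∞ (pairPhase k j) := by
  have hc (l : DiagonalIndex m) : ContDiff ℝ ∞ fun z => diagonalCoords m z l :=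
    (diagonalCoord l).contDiff
  by_cases hj : j = k
  · simp only [funext fun z => show pairPhase k j z = _ from if_pos hj]
    exact contDiff_normSq_diagonalCoords (.inl 1)
  · simp only [funext fun z => show pairPhase k j z = _ from if_neg hj]
    exact Complex.imCLM.contDiff.comp (((hc _).mul (hc _)).mul
      ((Complex.conjCLE.contDiff.comp (contDiff_apply ℝ ℂ 1)).pow 2))

theorem contDiff_ustilovskyIntegral (b : Fin m → Fin m → ℝ) (k : Fin m) (q : Fin 3 × Fin m) :
    ContDiff ℝ ∞ (ustilovskyIntegral b k q) := by
  obtain ⟨i, j⟩ := q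
  fin_cases i
  exacts [contDiff_torusHamiltonian _, contDiff_normSq_diagonalCoords _, contDiff_pairPhase k j]

end GenericIndependence

section Density

theorem dense_ne_zero_of_analyticOnNhd {E F : Type*} [NormedAddCommGroup E] [NormedSpace ℝ E]
    [NormedAddCommGroup F] [NormedSpace ℝ F] {f : E → F} (hf : AnalyticOnNhd ℝ f Set.univ) {x₀ : E}
    (h : f x₀ ≠ 0) : Dense {x | f x ≠ 0} := by
  refine dense_iff_inter_open.2 fun U hU hne => ?_
  obtain ⟨x, hx⟩ := hne
  by_contra hcon
  have hzero : ∀ y ∈ U, f y = 0 := fun y hy => by_contra fun h0 => hcon ⟨y, hy, h0⟩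
  have hf0 := hf.eq_of_eventuallyEq (g := fun _ => 0) (fun _ _ => analyticAt_const)
    (eventually_of_mem (hU.mem_nhds hx) hzero)
  exact h (congrFun hf0 x₀)

theorem mem_closure_inter_levelSet {X : Type*} [TopologicalSpace X] {S : ℝ → X → X}
    (hS : Continuous (Function.uncurry S)) {N : X → ℝ} (hN : Continuous N) {D : Set X}
    (hD : ∀ s, ∀ y ∈ D, S s y ∈ D) {x : X} (h0 : S 0 x = x)
    (hmono : StrictMono fun s => N (S s x)) (hx : x ∈ closure D) :
    x ∈ closure (D ∩ {y | N y = N x}) := by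
  refine mem_closure_iff_nhds.2 fun U hU => ?_
  have hcont (s : ℝ) : Continuous (S s) := hS.comp (Continuous.prodMk_right s)
  have hSx : ∀ᶠ q : ℝ × X in 𝓝 0 ×ˢ 𝓝 x, S q.1 q.2 ∈ U := by
    rw [← nhds_prod_eq]
    exact hS.continuousAt.preimage_mem_nhds (by simpa [h0] using hU)
  obtain ⟨P, hP, Q, hQ, hPQ⟩ := eventually_prod_iff.1 hSx
  obtain ⟨δ, hδ, hball⟩ := Metric.nhds_basis_closedBall.eventually_iff.1 hP
  rw [Real.closedBall_eq_Icc, zero_sub, zero_add] at hball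
  have hlow : N (S (-δ) x) < N x := by simpa [h0] using hmono (neg_lt_zero.2 hδ)
  have hhigh : N x < N (S δ x) := by simpa [h0] using hmono hδ
  have hlow' := (hN.comp (hcont (-δ))).continuousAt.eventually_lt_const hlow
  have hhigh' := (hN.comp (hcont δ)).continuousAt.eventually_const_lt hhigh
  obtain ⟨y, ⟨hyQ, hy1, hy2⟩, hyD⟩ := mem_closure_iff_nhds.1 hx _ (hQ.and (hlow'.and hhigh'))
  obtain ⟨s, hs, hsx⟩ := intermediate_value_Icc (neg_le_self hδ.le)
    (hN.comp (hS.comp (Continuous.prodMk_left y))).continuousOn ⟨hy1.le, hy2.le⟩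
  exact ⟨S s y, hPQ (hball hs) hyQ, hD s y hyD, hsx⟩

section BrieskornScale

variable {ι : Type*} {a : ι → ℕ}

/-- The weighted dilation `z_k ↦ e^{s / a_k} z_k`, which multiplies `∑ z_k ^ a_k` by `e^s`. -/
def brieskornScale (a : ι → ℕ) (s : ℝ) (z : ι → ℂ) (k : ι) : ℂ := Real.exp (s / a k) * z k

theorem brieskornScale_pow (s : ℝ) (z : ι → ℂ) {k : ι} (hk : a k ≠ 0) :
    brieskornScale a s z k ^ a k = Real.exp s * z k ^ a k := by
  rw [brieskornScale, mul_pow, ← Complex.ofReal_pow, ← Real.exp_nat_mul,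
    mul_div_cancel₀ _ (Nat.cast_ne_zero.2 hk)]

theorem strictMono_sqNorm_brieskornScale [Fintype ι] (ha : ∀ k, a k ≠ 0) {z : ι → ℂ} (hz : z ≠ 0) :
    StrictMono fun s => sqNorm (brieskornScale a s z) := by
  intro s t hst
  have hterm (r : ℝ) (k : ι) : Complex.normSq (brieskornScale a r z k) =
      Real.exp (r / a k) ^ 2 * Complex.normSq (z k) := by
    rw [brieskornScale, Complex.normSq_mul, Complex.normSq_ofReal, sq]
  have hexp (k : ι) : Real.exp (s / a k) ^ 2 < Real.exp (t / a k) ^ 2 := by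
    have := Nat.pos_of_ne_zero (ha k)
    gcongr
  obtain ⟨k, hk⟩ := Function.ne_iff.1 hz
  refine Finset.sum_lt_sum (fun k _ => ?_) ⟨k, Finset.mem_univ k, ?_⟩
  · rw [hterm, hterm]
    exact mul_le_mul_of_nonneg_right (hexp k).le (Complex.normSq_nonneg _)
  · rw [hterm, hterm]
    exact mul_lt_mul_of_pos_right (hexp k) (Complex.normSq_pos.2 hk)

end BrieskornScale

open ComplexConjugate

variable {m p : ℕ} {k : Fin m} {z : Fin (2 * m + 2) → ℂ}

theorem pairProduct_eq (j : Fin m) (z : Fin (2 * m + 2) → ℂ) :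
    pairProduct j z = z (fstIdx j) ^ 2 + z (sndIdx j) ^ 2 := by
  rw [pairProduct, diagonalCoords_inr_inl, diagonalCoords_inr_inr]
  linear_combination -z (sndIdx j) ^ 2 * Complex.I_sq

theorem IsGeneric.brieskornScale (hp : p ≠ 0) (hz : IsGeneric p k z) (s : ℝ) :
    IsGeneric p k (brieskornScale (fun k => if k = 0 then p else 2) s z) := by
  set z' := _root_.brieskornScale (fun k => if k = 0 then p else 2) s z
  have hpow (k : Fin (2 * m + 2)) :
      z' k ^ (if k = 0 then p else 2) = Real.exp s * z k ^ (if k = 0 then p else 2) :=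
    brieskornScale_pow s z (by split_ifs <;> simp [hp])
  have h0 : z' 0 ^ p = Real.exp s * z 0 ^ p := by simpa using hpow 0
  have h2 {k : Fin (2 * m + 2)} (hk : k ≠ 0) : z' k ^ 2 = Real.exp s * z k ^ 2 := by
    simpa [hk] using hpow k
  have hP (j : Fin m) : pairProduct j z' = Real.exp s * pairProduct j z := by
    rw [pairProduct_eq, pairProduct_eq, h2 (fstIdx_ne_zero j), h2 (sndIdx_ne_zero j), mul_add]
  refine ⟨?_, ?_, fun j hj => ?_⟩
  · exact mul_ne_zero (Complex.ofReal_ne_zero.2 (Real.exp_ne_zero _)) hz.one_ne_zero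
  · rw [h0, hP, map_mul, Complex.conj_ofReal, mul_mul_mul_comm, ← Complex.ofReal_mul,
      Complex.im_ofReal_mul]
    exact mul_ne_zero (by positivity) hz.im_ne_zero
  · rw [hP, ← map_pow, h2 (by simp), map_mul, Complex.conj_ofReal, mul_mul_mul_comm,
      ← Complex.ofReal_mul, Complex.re_ofReal_mul, map_pow]
    exact mul_ne_zero (by positivity) (hz.re_ne_zero j hj)

/-- The polynomial `ustilovskyPoly p` without the monomial of the `k`-th pair. -/
def ustilovskyResidual (p : ℕ) (k : Fin m) (Z : DiagonalIndex m → ℂ) : ℂ :=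
  Z (.inl 0) ^ p + Z (.inl 1) ^ 2 +
    ∑ j ∈ Finset.univ.erase k, Z (.inr (.inl j)) * Z (.inr (.inr j))

theorem ustilovskyPoly_eq_residual_add (p : ℕ) (k : Fin m) (Z : DiagonalIndex m → ℂ) :
    ustilovskyPoly p Z =
      ustilovskyResidual p k Z + Z (.inr (.inl k)) * Z (.inr (.inr k)) := by
  rw [ustilovskyPoly, ustilovskyResidual, ← Finset.sum_erase_add _ _ (Finset.mem_univ k),
    add_assoc _ (Finset.sum _ _)]

/-- On `ustilovskyPoly p Z = 0` this function vanishes exactly off the set `IsGeneric p k`; it does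
not depend on the coordinates of the `k`-th pair. -/
def genericity (p : ℕ) (k : Fin m) (Z : DiagonalIndex m → ℂ) : ℝ :=
  Complex.normSq (Z (.inl 1)) * (conj (Z (.inl 0) ^ p) * ustilovskyResidual p k Z).im *
    ∏ j ∈ Finset.univ.erase k,
      (Z (.inr (.inl j)) * Z (.inr (.inr j)) * conj (Z (.inl 1)) ^ 2).re

theorem isGeneric_iff_genericity_ne_zero (hz : ustilovskyPoly p (diagonalCoords m z) = 0) :
    IsGeneric p k z ↔ genericity p k (diagonalCoords m z) ≠ 0 := by
  have hres : ustilovskyResidual p k (diagonalCoords m z) = -pairProduct k z :=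
    eq_neg_of_add_eq_zero_left ((ustilovskyPoly_eq_residual_add p k _).symm.trans hz)
  rw [genericity, hres, mul_neg, Complex.neg_im, mul_ne_zero_iff, mul_ne_zero_iff,
    Finset.prod_ne_zero_iff, neg_ne_zero, (map_ne_zero _ : Complex.normSq _ ≠ 0 ↔ _)]
  exact ⟨fun h => ⟨⟨h.one_ne_zero, h.im_ne_zero⟩,
    fun j hj => h.re_ne_zero j (Finset.ne_of_mem_erase hj)⟩, fun h => ⟨h.1.1, h.1.2,
    fun j hj => h.2 j (Finset.mem_erase.2 ⟨hj, Finset.mem_univ j⟩)⟩⟩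

theorem analyticOnNhd_genericity (p : ℕ) (k : Fin m) :
    AnalyticOnNhd ℝ (genericity p k) Set.univ := by
  intro Z _
  have hproj (l : DiagonalIndex m) : AnalyticAt ℝ (fun Z : DiagonalIndex m → ℂ => Z l) Z :=
    (ContinuousLinearMap.proj (R := ℝ) (φ := fun _ : DiagonalIndex m => ℂ) l).analyticAt Z
  have hconj {f : (DiagonalIndex m → ℂ) → ℂ} (hf : AnalyticAt ℝ f Z) :
      AnalyticAt ℝ (fun Z => conj (f Z)) Z := (Complex.conjCLE.analyticAt _).comp hf
  have hre {f : (DiagonalIndex m → ℂ) → ℂ} (hf : AnalyticAt ℝ f Z) :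
      AnalyticAt ℝ (fun Z => (f Z).re) Z := (Complex.reCLM.analyticAt _).comp hf
  have him {f : (DiagonalIndex m → ℂ) → ℂ} (hf : AnalyticAt ℝ f Z) :
      AnalyticAt ℝ (fun Z => (f Z).im) Z := (Complex.imCLM.analyticAt _).comp hf
  have hres : AnalyticAt ℝ (ustilovskyResidual p k) Z :=
    (((hproj _).pow p).add ((hproj _).pow 2)).add
      (Finset.analyticAt_fun_sum _ fun j _ => (hproj _).mul (hproj _))
  have hnorm : AnalyticAt ℝ (fun Z : DiagonalIndex m → ℂ => Complex.normSq (Z (.inl 1))) Z :=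
    ((hre (hproj _)).mul (hre (hproj _))).add ((him (hproj _)).mul (him (hproj _)))
  exact (hnorm.mul (him ((hconj ((hproj _).pow p)).mul hres))).mul
    (Finset.analyticAt_fun_prod _ fun j _ =>
      hre (((hproj _).mul (hproj _)).mul ((hconj (hproj _)).pow 2)))

theorem exists_genericity_ne_zero (hp : p ≠ 0) (k : Fin m) :
    ∃ Z : DiagonalIndex m → ℂ, genericity p k Z ≠ 0 := by
  obtain ⟨x, hx⟩ := IsAlgClosed.exists_pow_nat_eq Complex.I (Nat.pos_of_ne_zero hp)
  refine ⟨Sum.elim ![x, 1] 1, ?_⟩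
  have hneg : (-((m - 1 : ℕ) : ℝ) + -1) ≠ 0 :=
    ne_of_lt (by linarith [Nat.cast_nonneg (α := ℝ) (m - 1)])
  simpa [genericity, ustilovskyResidual, hx] using hneg

theorem dense_genericity_ne_zero (hp : p ≠ 0) (k : Fin m) :
    Dense {Z | genericity p k Z ≠ 0} :=
  (exists_genericity_ne_zero hp k).elim fun _ =>
    dense_ne_zero_of_analyticOnNhd (analyticOnNhd_genericity p k)

/-- `l` and `l'` are the two indices of the `k`-th pair. -/
def IsPair (k : Fin m) (l l' : DiagonalIndex m) : Prop :=
  l = .inr (.inl k) ∧ l' = .inr (.inr k) ∨ l = .inr (.inr k) ∧ l' = .inr (.inl k)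

theorem ustilovskyPoly_eq_of_isPair {l l' : DiagonalIndex m} (h : IsPair k l l')
    (Z : DiagonalIndex m → ℂ) : ustilovskyPoly p Z = ustilovskyResidual p k Z + Z l * Z l' := by
  rw [ustilovskyPoly_eq_residual_add p k]
  obtain ⟨rfl, rfl⟩ | ⟨rfl, rfl⟩ := h
  exacts [rfl, congrArg _ (mul_comm _ _)]

theorem ustilovskyResidual_update {l l' : DiagonalIndex m} (h : IsPair k l l')
    (Z : DiagonalIndex m → ℂ) (c : ℂ) :
    ustilovskyResidual p k (Function.update Z l' c) = ustilovskyResidual p k Z := by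
  obtain ⟨-, rfl⟩ | ⟨-, rfl⟩ := h <;>
  · refine congrArg₂ (· + ·) (by simp) (Finset.sum_congr rfl fun j hj => ?_)
    simp [Finset.ne_of_mem_erase hj]

theorem genericity_update {l l' : DiagonalIndex m} (h : IsPair k l l')
    (Z : DiagonalIndex m → ℂ) (c : ℂ) :
    genericity p k (Function.update Z l' c) = genericity p k Z := by
  rw [genericity, ustilovskyResidual_update h]
  obtain ⟨-, rfl⟩ | ⟨-, rfl⟩ := h <;>
  · refine congrArg₂ (· * ·) (by simp) (Finset.prod_congr rfl fun j hj => ?_)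
    simp [Finset.ne_of_mem_erase hj]

/-- Where `Z l ≠ 0`, the equation `ustilovskyPoly p Z = 0` can be solved for `Z l'`; this retracts
an open set onto an open subset of the hypersurface, without changing `genericity`. -/
theorem mem_closure_genericity_of_ne_zero (hp : p ≠ 0) {l l' : DiagonalIndex m}
    (h : IsPair k l l') {Z : DiagonalIndex m → ℂ} (hZ : ustilovskyPoly p Z = 0) (hl : Z l ≠ 0) :
    Z ∈ closure {W | ustilovskyPoly p W = 0 ∧ genericity p k W ≠ 0} := by
  have hll' : l ≠ l' := by obtain ⟨rfl, rfl⟩ | ⟨rfl, rfl⟩ := h <;> simp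
  let r (W : DiagonalIndex m → ℂ) : DiagonalIndex m → ℂ :=
    Function.update W l' (-ustilovskyResidual p k W / W l)
  have hrZ : r Z = Z := by
    rw [ustilovskyPoly_eq_of_isPair h] at hZ
    refine Function.update_eq_self_iff.2 ?_
    rw [← eq_neg_of_add_eq_zero_right hZ, mul_div_cancel_left₀ _ hl]
  have hr : ContinuousAt r Z := by
    have hres : Continuous (ustilovskyResidual p k) := by
      unfold ustilovskyResidual
      fun_prop
    exact continuousAt_id.update l' (hres.neg.continuousAt.div (continuousAt_apply l Z) hl)
  have hmem : Z ∈ closure ({W | W l ≠ 0} ∩ {W | genericity p k W ≠ 0}) :=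
    (dense_genericity_ne_zero hp k).open_subset_closure_inter
      (isOpen_ne_fun (continuous_apply l) continuous_const) hl
  rw [← hrZ]
  refine closure_mono (Set.image_subset_iff.2 fun W hW => ?_) (mem_closure_image hr hmem)
  refine ⟨?_, (genericity_update h W _).trans_ne hW.2⟩
  simp only [r]
  rw [ustilovskyPoly_eq_of_isPair h, ustilovskyResidual_update h, Function.update_of_ne hll',
    Function.update_self, mul_div_cancel₀ _ hW.1, add_neg_cancel]

theorem mem_closure_genericity (hp : p ≠ 0) {Z : DiagonalIndex m → ℂ}
    (hZ : ustilovskyPoly p Z = 0) (k : Fin m) :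
    Z ∈ closure {W | ustilovskyPoly p W = 0 ∧ genericity p k W ≠ 0} := by
  by_cases hu : Z (.inr (.inl k)) = 0
  · by_cases hv : Z (.inr (.inr k)) = 0
    · have hcurve : Tendsto (Function.update Z (.inr (.inl k))) (𝓝[≠] 0) (𝓝 Z) := by
        have hcont := (continuous_const (y := Z)).update (.inr (.inl k)) continuous_id
        simpa [← hu] using (hcont.tendsto 0).mono_left nhdsWithin_le_nhds
      refine isClosed_closure.mem_of_tendsto hcurve (eventually_mem_nhdsWithin.mono fun c hc =>
        mem_closure_genericity_of_ne_zero hp (.inl ⟨rfl, rfl⟩) ?_ ?_)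
      · have hpair : IsPair k (.inr (.inr k)) (.inr (.inl k)) := .inr ⟨rfl, rfl⟩
        rw [ustilovskyPoly_eq_of_isPair hpair] at hZ ⊢
        rw [hv, zero_mul] at hZ
        rw [ustilovskyResidual_update hpair, Function.update_of_ne (by simp), hv, zero_mul, hZ]
      · rwa [Function.update_self]
    · exact mem_closure_genericity_of_ne_zero hp (.inr ⟨rfl, rfl⟩) hZ hv
  · exact mem_closure_genericity_of_ne_zero hp (.inl ⟨rfl, rfl⟩) hZ hu

theorem isOpen_setOf_genericity_ne_zero (p : ℕ) (k : Fin m) :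
    IsOpen {z | genericity p k (diagonalCoords m z) ≠ 0} :=
  isOpen_ne_fun ((analyticOnNhd_genericity p k).continuousOn.comp_continuous
    (diagonalCoords m).continuous fun _ => Set.mem_univ _) continuous_const

theorem mem_closure_isGeneric (hp : p ≠ 0) (hz : ustilovskyPoly p (diagonalCoords m z) = 0)
    (k : Fin m) :
    z ∈ closure {w | ustilovskyPoly p (diagonalCoords m w) = 0 ∧ IsGeneric p k w} := by
  have h : z ∈ diagonalCoords m ⁻¹' closure {W | ustilovskyPoly p W = 0 ∧ genericity p k W ≠ 0} :=
    mem_closure_genericity hp hz k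
  have hopen : IsOpenMap (diagonalCoords m) := (diagonalCoords m).toHomeomorph.isOpenMap
  rw [hopen.preimage_closure_eq_closure_preimage (diagonalCoords m).continuous] at h
  refine closure_mono ?_ h
  exact fun w hw => ⟨hw.1, (isGeneric_iff_genericity_ne_zero hw.1).2 hw.2⟩

theorem ustilovsky_carrier_subset_closure (hp : p ≠ 0) (k : Fin m) :
    (ustilovsky m p).carrier ⊆ closure ((ustilovsky m p).carrier ∩
      {z | genericity p k (diagonalCoords m z) ≠ 0}) := by
  intro z hz
  have hz0 : z ≠ 0 := Function.ne_iff.2 (exists_ne_zero_of_mem_brieskorn_carrier hz)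
  obtain ⟨hz1, hzP⟩ := mem_ustilovsky_carrier.1 hz
  let a (k : Fin (2 * m + 2)) : ℕ := if k = 0 then p else 2
  have ha (k) : a k ≠ 0 := by simp only [a]; split_ifs <;> simp [hp]
  have hS : Continuous (Function.uncurry (brieskornScale a)) := by
    unfold brieskornScale
    fun_prop
  refine closure_mono ?_ (mem_closure_inter_levelSet hS contDiff_sqNorm.continuous ?_
    (by ext; simp [brieskornScale]) (strictMono_sqNorm_brieskornScale ha hz0)
    (mem_closure_isGeneric hp hzP k))
  · rintro w ⟨⟨hwP, hw⟩, hw1⟩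
    exact ⟨mem_ustilovsky_carrier.2 ⟨hw1.trans hz1, hwP⟩,
      (isGeneric_iff_genericity_ne_zero hwP).1 hw⟩
  · rintro s w ⟨hwP, hw⟩
    refine ⟨?_, hw.brieskornScale hp s⟩
    rw [← sum_pow_eq_ustilovskyPoly] at hwP ⊢
    rw [Finset.sum_congr rfl fun k _ => brieskornScale_pow s w (ha k), ← Finset.mul_sum, hwP,
      mul_zero]

end Density

section RegularPoints

variable {m p : ℕ} {z : Fin (2 * m + 2) → ℂ}

theorem ustilovskyPoly_torusAction (hp : p ≠ 0) (t : Fin (m + 1) → ℝ) (z : Fin (2 * m + 2) → ℂ) :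
    ustilovskyPoly p (diagonalCoords m (torusAction p t z)) =
      Complex.exp (4 * t 0 * Complex.I) * ustilovskyPoly p (diagonalCoords m z) := by
  have hp' : (p : ℂ) ≠ 0 := Nat.cast_ne_zero.2 hp
  simp only [ustilovskyPoly, diagonalCoords_torusAction, mul_pow, ← Complex.exp_nat_mul,
    mul_mul_mul_comm (Complex.exp _), ← Complex.exp_add, mul_add, Finset.mul_sum]
  refine congrArg₂ (· + ·) (congrArg₂ (· + ·) ?_ ?_) (Finset.sum_congr rfl fun j _ => ?_) <;>
  · congr 2
    simp only [torusWeight_inl_zero, torusWeight_inl_one, torusWeight_inr_inl,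
      torusWeight_inr_inr]
    push_cast
    field_simp <;> ring

theorem torusAction_mem_carrier (hp : p ≠ 0) (hz : z ∈ (ustilovsky m p).carrier)
    (t : Fin (m + 1) → ℝ) : torusAction p t z ∈ (ustilovsky m p).carrier := by
  rw [mem_ustilovsky_carrier] at hz ⊢
  rw [← torusHamiltonian_single_zero] at hz ⊢
  rwa [isTorusInvariant_torusHamiltonian _ t z, ustilovskyPoly_torusAction hp,
    mul_eq_zero_iff_left (Complex.exp_ne_zero _)]

theorem torusField_torusAction_injective (h : Function.Injective (torusField p z))
    (t : Fin (m + 1) → ℝ) : Function.Injective (torusField p (torusAction p t z)) := by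
  have hA : Function.Injective (torusAction p t : (Fin (2 * m + 2) → ℂ) →L[ℝ] _) :=
    Function.LeftInverse.injective (neg_apply_apply (torusAction p) t)
  intro u v huv
  rw [← torusAction_torusField, ← torusAction_torusField] at huv
  exact h (hA huv)

theorem injective_torusField_of_linearIndependent {b : Fin m → Fin m → ℝ}
    (hb : LinearIndependent ℝ b) (hp : p ≠ 0) (hz : z ∈ (ustilovsky m p).carrier)
    (hind : LinearIndependent ℝ fun j =>
      (fderiv ℝ (torusHamiltonian (Fin.cons 1 (b j))) z).toLinearMap ∘ₗ
        ((ustilovsky m p).tangent z).subtype) : Function.Injective (torusField p z) := by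
  rw [injective_iff_map_eq_zero]
  intro v hv
  have hspan : Submodule.span ℝ (Set.range b) = ⊤ :=
    hb.span_eq_top_of_card_eq_finrank' (by simp)
  obtain ⟨c, hc⟩ := (Submodule.mem_span_range_iff_exists_fun ℝ).1
    (hspan ▸ Submodule.mem_top : Fin.tail v ∈ _)
  have hv_eq : v = ∑ j, c j • (Fin.cons 1 (b j) : Fin (m + 1) → ℝ) +
      (v 0 - ∑ j, c j) • Pi.single 0 1 := by
    ext i
    refine Fin.cases ?_ (fun i => ?_) i
    · simp
    · simpa [Fin.tail] using (congrFun hc i).symm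
  have hc0 (j) : c j = 0 := by
    refine Fintype.linearIndependent_iff.1 hind c (LinearMap.ext fun w => ?_) j
    have hw := (isLinearMap_fderiv_torusHamiltonian z (w : Fin (2 * m + 2) → ℂ)).mk'.congr_arg hv_eq
    have hdv : fderiv ℝ (torusHamiltonian v) z w = 0 := by
      rw [← neg_eq_zero, ← ustilovsky_dform_torusField hp z, hv]
      simp [FormOnLevelSet.dform]
    simp only [map_add, map_sum, map_smul, IsLinearMap.mk'_apply, hdv,
      torusHamiltonian_single_zero, (mem_brieskorn_tangent.1 w.2).1, smul_zero, add_zero] at hw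
    simpa [_root_.sum_apply] using hw.symm
  have hsucc (j : Fin m) : v j.succ = 0 := by
    simpa [hc0, Fin.tail] using (congrFun hc j).symm
  have hv0 : v 0 = 0 := by
    have h := ustilovsky_form_torusField hp z v
    simpa [hv, torusHamiltonian, hsucc, (mem_ustilovsky_carrier.1 hz).1] using h.symm
  exact funext (Fin.cases hv0 hsucc)

theorem fderiv_torusAction_comp (z : Fin (2 * m + 2) → ℂ)
    (B : (Fin (m + 1) → ℝ) ≃ₗ[ℝ] (Fin (m + 1) → ℝ)) (θ v : Fin (m + 1) → ℝ) :
    fderiv ℝ (fun θ => torusAction p (B θ) z) θ v =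
      torusField p (torusAction p (B θ) z) (B v) := by
  have hB : HasFDerivAt B B.toLinearMap.toContinuousLinearMap θ :=
    B.toLinearMap.toContinuousLinearMap.hasFDerivAt
  have h := (hasFDerivAt_torusAction_apply (p := p) z (B θ)).comp θ hB
  exact congrArg (· v) h.fderiv

theorem isPreIsotropicTorus_torusAction (hp : p ≠ 0) (hz : z ∈ (ustilovsky m p).carrier)
    (hinj : Function.Injective (torusField p z))
    {b : Basis (Fin (m + 1)) ℝ (Fin (m + 1) → ℝ)}
    (hb : ∀ t, torusAction p t z = z ↔ ∃ k : Fin (m + 1) → ℤ, ∀ i, b.repr t i = k i) :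
    (ustilovsky m p).IsPreIsotropicTorus (m + 1)
      fun θ => torusAction p (b.equivFun.symm θ) z where
  smooth := (contDiff_torusAction_apply z).comp
    (LinearMap.toContinuousLinearMap b.equivFun.symm.toLinearMap).contDiff
  immersion θ u v huv := by
    rw [fderiv_torusAction_comp, fderiv_torusAction_comp] at huv
    exact b.equivFun.symm.injective (torusField_torusAction_injective hinj _ huv)
  eq_iff := apply_equivFun_symm_eq_iff hb
  mem θ := torusAction_mem_carrier hp hz _
  transversal θ := by
    refine ⟨b.equivFun (Pi.single 0 1), ?_⟩
    rw [fderiv_torusAction_comp, LinearEquiv.symm_apply_apply, ustilovsky_form_torusField hp,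
      torusHamiltonian_single_zero,
      (mem_ustilovsky_carrier.1 (torusAction_mem_carrier hp hz _)).1]
    exact one_ne_zero
  isotropic θ u v _ _ := by
    rw [fderiv_torusAction_comp, fderiv_torusAction_comp, ustilovsky_dform_torusField hp,
      fderiv_torusHamiltonian_torusField hp, neg_zero]

theorem range_torusField_eq_span (hp : p ≠ 0) (hz : z ∈ (ustilovsky m p).carrier) :
    LinearMap.range (torusField p z).toLinearMap =
      Submodule.span ℝ (insert ((ustilovsky m p).reeb z)
        (Set.range fun j : Fin m => (ustilovsky m p).contactField (ustilovskyG j) z)) := by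
  have hrange : Set.range (fun i => torusField p z (Pi.single i 1)) =
      insert ((ustilovsky m p).reeb z)
        (Set.range fun j : Fin m => (ustilovsky m p).contactField (ustilovskyG j) z) := by
    rw [← Fin.cons_self_tail (fun i => torusField p z (Pi.single i 1)), Fin.range_cons,
      ← reeb_ustilovsky hp hz]
    simp only [← torusHamiltonian_single_succ, contactField_torusHamiltonian hp hz]
    rfl
  rw [← hrange, LinearMap.range_eq_map, ← (Pi.basisFun ℝ (Fin (m + 1))).span_eq,
    Submodule.map_span, ← Set.range_comp]
  refine congrArg (fun s => Submodule.span ℝ (Set.range s)) (funext fun i => ?_)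
  simp

variable {F : Fin (3 * m) → (Fin (2 * m + 2) → ℂ) → ℝ}

theorem exists_torusField_eq_of_fderiv_eq_zero (hp : p ≠ 0) (hz : z ∈ (ustilovsky m p).carrier)
    (hF : ∀ i, IsTorusInvariant p (F i)) (hd : ∀ i, Differentiable ℝ (F i))
    (hind : (ustilovsky m p).IndependentAt F z) (hinj : Function.Injective (torusField p z))
    {w : Fin (2 * m + 2) → ℂ} (hw : w ∈ (ustilovsky m p).tangent z)
    (hwF : ∀ i, fderiv ℝ (F i) z w = 0) : ∃ v, torusField p z v = w := by
  let D : (Fin (m + 1) → ℝ) →ₗ[ℝ] (ustilovsky m p).tangent z :=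
    (torusField p z).toLinearMap.codRestrict _ (torusField_mem_tangent hp hz)
  have hD : Function.Injective D := fun u v h => hinj (congrArg Subtype.val h)
  have hle : LinearMap.range D ≤
      ⨅ i, LinearMap.ker ((fderiv ℝ (F i) z).toLinearMap ∘ₗ
        ((ustilovsky m p).tangent z).subtype) := by
    rintro _ ⟨v, rfl⟩
    exact (Submodule.mem_iInf _).2 fun i => (hF i).fderiv_torusField (hd i) z v
  have hrank := finrank_iInf_ker_of_linearIndependent hind
  rw [(isContact_ustilovsky hp).dimension z hz] at hrank
  have heq := Submodule.eq_of_le_of_finrank_eq hle (by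
    rw [LinearMap.finrank_range_of_inj hD, finrank_fin_fun]
    omega)
  have hwD : (⟨w, hw⟩ : (ustilovsky m p).tangent z) ∈ LinearMap.range D := by
    rw [heq]
    exact (Submodule.mem_iInf _).2 hwF
  obtain ⟨v, hv⟩ := hwD
  exact ⟨v, congrArg Subtype.val hv⟩

theorem eventually_mem_orbit (hp : p ≠ 0) (hz : z ∈ (ustilovsky m p).carrier)
    (hF : ∀ i, IsTorusInvariant p (F i)) (hd : ∀ i, ContDiff ℝ ∞ (F i))
    (hind : (ustilovsky m p).IndependentAt F z) (hinj : Function.Injective (torusField p z)) :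
    ∀ᶠ w in 𝓝 z, w ∈ {w ∈ (ustilovsky m p).carrier | ∀ i, F i w = F i z} →
      w ∈ Set.range fun t => torusAction p t z := by
  have hzero : torusAction p 0 z = z := by simp
  have hconstraint := (isContact_ustilovsky (m := m) hp).smooth_constraint
  have hG : HasStrictFDerivAt (fun w => ((ustilovsky m p).constraint w, fun i => F i w))
      ((fderiv ℝ (ustilovsky m p).constraint z).prod (.pi fun i => fderiv ℝ (F i) z))
      (torusAction p 0 z) := by
    rw [hzero]
    exact (hconstraint.contDiffAt.hasStrictFDerivAt (by simp)).prodMk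
      (hasStrictFDerivAt_pi.2 fun i => (hd i).contDiffAt.hasStrictFDerivAt (by simp))
  have h := eventually_mem_range_of_mem_fibre (φ := fun t => torusAction p t z) hG
    (hasStrictFDerivAt_torusAction_apply z 0) (by rwa [hzero]) (fun v hv => ?_) fun s => ?_
  · simp only [hzero] at h
    filter_upwards [h] with w hw hwS
    exact hw (Prod.ext (Eq.trans hwS.1 hz.symm) (funext hwS.2))
  · rw [hzero]
    obtain ⟨hv₁, hv₂⟩ := Prod.ext_iff.1 hv
    exact exists_torusField_eq_of_fderiv_eq_zero hp hz hF
      (fun i => (hd i).differentiable (by simp)) hind hinj hv₁ (congrFun hv₂)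
  · refine Prod.ext ?_ (funext fun i => ?_)
    · exact Eq.trans (torusAction_mem_carrier hp hz s) (torusAction_mem_carrier hp hz 0).symm
    · exact (hF i s z).trans (hF i 0 z).symm

theorem exists_isPreIsotropicTorus (hp : p ≠ 0) (hz : z ∈ (ustilovsky m p).carrier)
    (hF : ∀ i, IsTorusInvariant p (F i)) (hd : ∀ i, ContDiff ℝ ∞ (F i))
    (hind : (ustilovsky m p).IndependentAt F z) (hinj : Function.Injective (torusField p z)) :
    ∃ B : (Fin (m + 1) → ℝ) ≃ₗ[ℝ] (Fin (m + 1) → ℝ),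
      (ustilovsky m p).IsPreIsotropicTorus (m + 1) (fun θ => torusAction p (B θ) z) ∧
      (Set.range fun θ => torusAction p (B θ) z) =
        connectedComponentIn {w ∈ (ustilovsky m p).carrier | ∀ i, F i w = F i z} z := by
  have hstrict := hasStrictFDerivAt_torusAction_apply (p := p) z 0
  rw [AddChar.map_zero_eq_one, one_apply_eq_self] at hstrict
  have hcont := (contDiff_torusAction_apply (p := p) z).continuous
  have := discreteTopology_stabilizerLattice hstrict hinj
  have := isZLattice_stabilizerLattice (c := fun _ => p * Real.pi) (by simp [hp])
    fun i => torusAction_single_period hp i z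
  obtain ⟨b, hb⟩ := exists_basis_apply_eq_self_iff (A := torusAction p) (z := z)
  refine ⟨b.equivFun.symm, isPreIsotropicTorus_torusAction hp hz hinj hb, ?_⟩
  rw [← range_orbit_eq_connectedComponentIn (A := torusAction p) (z := z)
    (S := {w ∈ (ustilovsky m p).carrier | ∀ i, F i w = F i z}) ⟨hz, fun _ => rfl⟩
    (fun t w hw => ⟨torusAction_mem_carrier hp hw.1 t, fun i => (hF i t w).trans (hw.2 i)⟩) hcont
    (isCompact_range_orbit hcont).isClosed (eventually_mem_orbit hp hz hF hd hind hinj)]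
  exact b.equivFun.symm.surjective.range_comp fun t => torusAction p t z

end RegularPoints

section Integrability

variable {m p : ℕ} {z : Fin (2 * m + 2) → ℂ}

section Invariant

variable {f : (Fin (2 * m + 2) → ℂ) → ℝ}

theorem IsTorusInvariant.isIntegralOf_torusHamiltonian (hf : IsTorusInvariant p f)
    (hd : Differentiable ℝ f) (hp : p ≠ 0) (v : Fin (m + 1) → ℝ) :
    (ustilovsky m p).IsIntegralOf (torusHamiltonian v) f := fun z hz => by
  rw [contactField_torusHamiltonian hp hz, hf.fderiv_torusField hd]

theorem IsTorusInvariant.fderiv_reeb (hf : IsTorusInvariant p f) (hd : Differentiable ℝ f)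
    (hp : p ≠ 0) (hz : z ∈ (ustilovsky m p).carrier) :
    fderiv ℝ f z ((ustilovsky m p).reeb z) = 0 := by
  rw [reeb_ustilovsky hp hz, hf.fderiv_torusField hd]

theorem IsTorusInvariant.bracket_one (hf : IsTorusInvariant p f) (hd : Differentiable ℝ f)
    (hp : p ≠ 0) (hz : z ∈ (ustilovsky m p).carrier) :
    (ustilovsky m p).bracket (fun _ => 1) f z = 0 :=
  ((isContact_ustilovsky hp).bracket_one hz).trans (hf.fderiv_reeb hd hp hz)

theorem IsTorusInvariant.bracket_torusHamiltonian (hf : IsTorusInvariant p f)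
    (hd : Differentiable ℝ f) (hp : p ≠ 0) (v : Fin (m + 1) → ℝ)
    (hz : z ∈ (ustilovsky m p).carrier) :
    (ustilovsky m p).bracket f (torusHamiltonian v) z = 0 := by
  have hg := (isTorusInvariant_torusHamiltonian (p := p) v).fderiv_reeb
    ((contDiff_torusHamiltonian v).differentiable (by simp)) hp hz
  rw [(isContact_ustilovsky hp).bracket_eq_neg_fderiv_contactField hz (hf.fderiv_reeb hd hp hz) hg,
    hf.isIntegralOf_torusHamiltonian hd hp v z hz, neg_zero]

end Invariant

variable {b : Fin m → Fin m → ℝ} {k : Fin m}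

theorem ustilovskyIntegrals_of_lt (b : Fin m → Fin m → ℝ) (k : Fin m) {i : Fin (3 * m)}
    (hi : i.val < m) :
    ustilovskyIntegrals b k i = torusHamiltonian (Fin.cons 1 (b ⟨i, hi⟩)) := by
  have h : finProdFinEquiv.symm i = ((0, ⟨i, hi⟩) : Fin 3 × Fin m) :=
    (Equiv.symm_apply_eq _).2 (Fin.ext (by simp [finProdFinEquiv]))
  rw [ustilovskyIntegrals, h]
  rfl

theorem isTorusInvariant_ustilovskyIntegrals (b : Fin m → Fin m → ℝ) (k : Fin m)
    (i : Fin (3 * m)) : IsTorusInvariant p (ustilovskyIntegrals b k i) :=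
  isTorusInvariant_ustilovskyIntegral b k _

theorem contDiff_ustilovskyIntegrals (b : Fin m → Fin m → ℝ) (k : Fin m) (i : Fin (3 * m)) :
    ContDiff ℝ ∞ (ustilovskyIntegrals b k i) :=
  contDiff_ustilovskyIntegral b k _

theorem injective_torusField_of_independentAt (hb : LinearIndependent ℝ b) (hp : p ≠ 0)
    (hz : z ∈ (ustilovsky m p).carrier)
    (hind : (ustilovsky m p).IndependentAt (ustilovskyIntegrals b k) z) :
    Function.Injective (torusField p z) := by
  refine injective_torusField_of_linearIndependent hb hp hz ?_
  have hinj : Function.Injective fun j : Fin m => finProdFinEquiv ((0 : Fin 3), j) :=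
    finProdFinEquiv.injective.comp (Prod.mk_right_injective 0)
  have h := LinearIndependent.comp hind _ hinj
  simp only [Function.comp_def, ustilovskyIntegrals, Equiv.symm_apply_apply] at h
  exact h

theorem isNoncommutativelyIntegrable_ustilovskyH (hb : LinearIndependent ℝ b) (hp : p ≠ 0)
    (hm : 0 < m) {ε : Fin m → ℝ} (hε : ε = b ⟨0, hm⟩ ∨ ε = 0) :
    (ustilovsky m p).IsNoncommutativelyIntegrable (2 * m) m (ustilovskyH ε)
      (ustilovskyIntegrals b ⟨0, hm⟩) where
  contact := isContact_ustilovsky hp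
  count := by omega
  le := by omega
  smooth := contDiff_ustilovskyIntegrals b _
  hamiltonian := by
    refine hε.imp (fun h => ⟨by omega, hm, ?_⟩) fun h z hz => ?_
    · rw [h, ustilovskyIntegrals_of_lt b _ hm, torusHamiltonian_cons_one]
      exact Set.eqOn_refl _ _
    · simp [ustilovskyH, h, (mem_ustilovsky_carrier.1 hz).1]
  isIntegral i := by
    rw [← torusHamiltonian_cons_one]
    exact (isTorusInvariant_ustilovskyIntegrals b _ i).isIntegralOf_torusHamiltonian
      ((contDiff_ustilovskyIntegrals b _ i).differentiable (by simp)) hp _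
  bracket_one i z hz := (isTorusInvariant_ustilovskyIntegrals b _ i).bracket_one
    ((contDiff_ustilovskyIntegrals b _ i).differentiable (by simp)) hp hz
  bracket_eq_zero i j hj z hz := by
    rw [ustilovskyIntegrals_of_lt b _ hj]
    exact (isTorusInvariant_ustilovskyIntegrals b _ i).bracket_torusHamiltonian
      ((contDiff_ustilovskyIntegrals b _ i).differentiable (by simp)) hp _ hz
  independent := ⟨_, isOpen_setOf_genericity_ne_zero p ⟨0, hm⟩,
    ustilovsky_carrier_subset_closure hp _, fun z hz => independentAt_of_isGeneric hb hp
      ((isGeneric_iff_genericity_ne_zero (mem_ustilovsky_carrier.1 hz.1).2).2 hz.2)⟩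

theorem exists_linearIndependent_apply_eq (hm : 0 < m) (ε : Fin m → ℝ) :
    ∃ b : Fin m → Fin m → ℝ, LinearIndependent ℝ b ∧ (ε = b ⟨0, hm⟩ ∨ ε = 0) := by
  let e : Basis (Fin m) ℝ (Fin m → ℝ) := Pi.basisFun ℝ (Fin m)
  by_cases hε : ε = 0
  · exact ⟨e, e.linearIndependent, .inr hε⟩
  · obtain ⟨A, hA⟩ := SeparatingDual.exists_continuousLinearEquiv_apply_eq (R := ℝ)
      (e.ne_zero ⟨0, hm⟩) hε
    exact ⟨A ∘ e, e.linearIndependent.map' A.toLinearMap A.toLinearEquiv.ker, .inl hA.symm⟩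

section OrbitParametrization

variable {B : (Fin (m + 1) → ℝ) ≃ₗ[ℝ] (Fin (m + 1) → ℝ)}

theorem range_fderiv_torusAction_comp (hp : p ≠ 0) {θ : Fin (m + 1) → ℝ}
    (hθ : torusAction p (B θ) z ∈ (ustilovsky m p).carrier) :
    LinearMap.range ((fderiv ℝ (fun θ => torusAction p (B θ) z) θ :
          (Fin (m + 1) → ℝ) →L[ℝ] _) : (Fin (m + 1) → ℝ) →ₗ[ℝ] (Fin (2 * m + 2) → ℂ)) =
      Submodule.span ℝ (insert ((ustilovsky m p).reeb (torusAction p (B θ) z))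
        (Set.range fun j : Fin m =>
          (ustilovsky m p).contactField (ustilovskyG j) (torusAction p (B θ) z))) := by
  have h : ((fderiv ℝ (fun θ => torusAction p (B θ) z) θ : (Fin (m + 1) → ℝ) →L[ℝ] _) :
        (Fin (m + 1) → ℝ) →ₗ[ℝ] (Fin (2 * m + 2) → ℂ)) =
      (torusField p (torusAction p (B θ) z)).toLinearMap ∘ₗ B.toLinearMap :=
    LinearMap.ext (fderiv_torusAction_comp z B θ)
  rw [h, LinearMap.range_comp_of_range_eq_top _ (LinearEquiv.range B),
    range_torusField_eq_span hp hθ]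

theorem exists_fderiv_torusAction_comp_eq_reeb (hp : p ≠ 0)
    (hB : ∀ θ, torusAction p (B θ) z ∈ (ustilovsky m p).carrier) :
    ∃ c, ∀ θ, fderiv ℝ (fun θ => torusAction p (B θ) z) θ c =
      (ustilovsky m p).reeb (torusAction p (B θ) z) :=
  ⟨B.symm (Pi.single 0 1), fun θ => by
    rw [fderiv_torusAction_comp, LinearEquiv.apply_symm_apply, reeb_ustilovsky hp (hB θ)]⟩

theorem exists_fderiv_torusAction_comp_eq_contactField (hp : p ≠ 0)
    (hB : ∀ θ, torusAction p (B θ) z ∈ (ustilovsky m p).carrier) (v : Fin (m + 1) → ℝ) :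
    ∃ c, ∀ θ, fderiv ℝ (fun θ => torusAction p (B θ) z) θ c =
      (ustilovsky m p).contactField (torusHamiltonian v) (torusAction p (B θ) z) :=
  ⟨B.symm v, fun θ => by
    rw [fderiv_torusAction_comp, LinearEquiv.apply_symm_apply,
      contactField_torusHamiltonian hp (hB θ)]⟩

end OrbitParametrization

end Integrability

theorem proposition4p3_general (m p : ℕ) (hm : 0 < m) (hp : p ≠ 0) (ε : Fin m → ℝ) :
    ∃ F : Fin (3 * m) → (Fin (2 * m + 2) → ℂ) → ℝ,
      (ustilovsky m p).IsNoncommutativelyIntegrable (2 * m) m (ustilovskyH ε) F ∧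
      (∀ j, (ustilovsky m p).IsIntegralOf (ustilovskyH ε) (ustilovskyG j)) ∧
      (∀ j, ∀ z ∈ (ustilovsky m p).carrier,
        (ustilovsky m p).bracket (fun _ => 1) (ustilovskyG j) z = 0) ∧
      (∀ i j, ∀ z ∈ (ustilovsky m p).carrier,
        (ustilovsky m p).bracket (ustilovskyG i) (ustilovskyG j) z = 0) ∧
      (∀ i j, ∀ z ∈ (ustilovsky m p).carrier,
        (ustilovsky m p).bracket (F i) (ustilovskyG j) z = 0) ∧
      ∀ z ∈ (ustilovsky m p).carrier, (ustilovsky m p).IndependentAt F z →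
        ∃ φ : (Fin (m + 1) → ℝ) → (Fin (2 * m + 2) → ℂ),
          (ustilovsky m p).IsPreIsotropicTorus (m + 1) φ ∧
          Set.range φ =
            connectedComponentIn {w ∈ (ustilovsky m p).carrier | ∀ i, F i w = F i z} z ∧
          (∀ θ, LinearMap.range ((fderiv ℝ φ θ : (Fin (m + 1) → ℝ) →L[ℝ] _) :
                (Fin (m + 1) → ℝ) →ₗ[ℝ] (Fin (2 * m + 2) → ℂ)) =
            Submodule.span ℝ (insert ((ustilovsky m p).reeb (φ θ))
              (Set.range fun j : Fin m =>
                (ustilovsky m p).contactField (ustilovskyG j) (φ θ)))) ∧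
          (∃ c, ∀ θ, fderiv ℝ φ θ c = (ustilovsky m p).reeb (φ θ)) ∧
          (∀ j, ∃ c, ∀ θ, fderiv ℝ φ θ c =
            (ustilovsky m p).contactField (ustilovskyG j) (φ θ)) ∧
          (∃ c, ∀ θ, fderiv ℝ φ θ c =
            (ustilovsky m p).contactField (ustilovskyH ε) (φ θ)) := by
  obtain ⟨b, hb, hε⟩ := exists_linearIndependent_apply_eq hm ε
  let F := ustilovskyIntegrals b ⟨0, hm⟩
  have hF (i) : IsTorusInvariant p (F i) := isTorusInvariant_ustilovskyIntegrals b _ i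
  have hFs (i) : ContDiff ℝ ∞ (F i) := contDiff_ustilovskyIntegrals b _ i
  have hG (j : Fin m) : IsTorusInvariant p (ustilovskyG j) :=
    torusHamiltonian_single_succ j ▸ isTorusInvariant_torusHamiltonian _
  have hGs (j : Fin m) : Differentiable ℝ (ustilovskyG j) :=
    torusHamiltonian_single_succ j ▸ (contDiff_torusHamiltonian _).differentiable (by simp)
  refine ⟨F, isNoncommutativelyIntegrable_ustilovskyH hb hp hm hε,
    fun j => torusHamiltonian_cons_one ε ▸ (hG j).isIntegralOf_torusHamiltonian (hGs j) hp _,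
    fun j z hz => (hG j).bracket_one (hGs j) hp hz,
    fun i j z hz => torusHamiltonian_single_succ j ▸
      (hG i).bracket_torusHamiltonian (hGs i) hp _ hz,
    fun i j z hz => torusHamiltonian_single_succ j ▸
      (hF i).bracket_torusHamiltonian ((hFs i).differentiable (by simp)) hp _ hz,
    fun z hz hind => ?_⟩
  obtain ⟨B, hφ, hrange⟩ := exists_isPreIsotropicTorus hp hz hF hFs hind
    (injective_torusField_of_independentAt hb hp hz hind)
  exact ⟨_, hφ, hrange, fun θ => range_fderiv_torusAction_comp hp (hφ.mem θ),
    exists_fderiv_torusAction_comp_eq_reeb hp hφ.mem,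
    fun j => torusHamiltonian_single_succ j ▸
      exists_fderiv_torusAction_comp_eq_contactField hp hφ.mem _,
    torusHamiltonian_cons_one ε ▸
      exists_fderiv_torusAction_comp_eq_contactField hp hφ.mem _⟩

end

theorem proposition4p3 (m p : ℕ) (hm : 0 < m) (hp : p % 8 = 1 ∨ p % 8 = 7)
    (ε : Fin m → ℝ) (hε : ∀ j, 0 < ε j ∧ ε j < 1) :
    -- `B_p` is a contact manifold of dimension `4 m + 1`, and the contact flow of `H` on it is
    -- noncommutatively integrable, through `3 m` integrals, with `r = m`
    ∃ F : Fin (3 * m) → (Fin (2 * m + 2) → ℂ) → ℝ,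
      (ustilovsky m p).IsNoncommutativelyIntegrable (2 * m) m (ustilovskyH ε) F ∧
      -- the `g_j` are integrals of it, commuting with `1`, with each other and with all `F i`
      (∀ j, (ustilovsky m p).IsIntegralOf (ustilovskyH ε) (ustilovskyG j)) ∧
      (∀ j, ∀ z ∈ (ustilovsky m p).carrier,
        (ustilovsky m p).bracket (fun _ => 1) (ustilovskyG j) z = 0) ∧
      (∀ i j, ∀ z ∈ (ustilovsky m p).carrier,
        (ustilovsky m p).bracket (ustilovskyG i) (ustilovskyG j) z = 0) ∧
      (∀ i j, ∀ z ∈ (ustilovsky m p).carrier,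
        (ustilovsky m p).bracket (F i) (ustilovskyG j) z = 0) ∧
      -- through every regular point, the connected component of the common level set of the
      -- integrals is a pre-isotropic torus `T` of dimension `m + 1`
      ∀ z ∈ (ustilovsky m p).carrier, (ustilovsky m p).IndependentAt F z →
        ∃ φ : (Fin (m + 1) → ℝ) → (Fin (2 * m + 2) → ℂ),
          (ustilovsky m p).IsPreIsotropicTorus (m + 1) φ ∧
          Set.range φ =
            connectedComponentIn {w ∈ (ustilovsky m p).carrier | ∀ i, F i w = F i z} z ∧
          -- its tangent spaces are spanned by `Z` and `Y_{g_1}, …, Y_{g_m}`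
          (∀ θ, LinearMap.range ((fderiv ℝ φ θ : (Fin (m + 1) → ℝ) →L[ℝ] _) :
                (Fin (m + 1) → ℝ) →ₗ[ℝ] (Fin (2 * m + 2) → ℂ)) =
            Submodule.span ℝ (insert ((ustilovsky m p).reeb (φ θ))
              (Set.range fun j : Fin m =>
                (ustilovsky m p).contactField (ustilovskyG j) (φ θ)))) ∧
          -- the flows of `Z`, `Y_{g_j}` and `Y_H` act on it by translations
          (∃ c, ∀ θ, fderiv ℝ φ θ c = (ustilovsky m p).reeb (φ θ)) ∧
          (∀ j, ∃ c, ∀ θ, fderiv ℝ φ θ c =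
            (ustilovsky m p).contactField (ustilovskyG j) (φ θ)) ∧
          (∃ c, ∀ θ, fderiv ℝ φ θ c =
            (ustilovsky m p).contactField (ustilovskyH ε) (φ θ)) :=
  proposition4p3_general m p hm (by omega) ε
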